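/- Let $\Gamma\subset\mathbb{R}^3$ be a compact connected $C^\infty$ surface without boundary, oriented by a continuous unit normal field $\nu$. Let $d$ be the signed distance to $\Gamma$ (increasing in the direction of $\nu$) and $\pi$ the closest point projection onto $\Gamma$; in a thin tube around $\Gamma$ these are well defined and smooth. There put $\nu(x)=\nu(\pi(x))$, $P=I-\nu\otimes\nu$ and $H=\nabla^2 d$. Let $k\ge 1$. Fix a Lagrange element of degree $k$ on the reference triangle $K$, i.e. $\dim\mathbb{P}_k$ nodes $x_j\in K$ with Lagrange basis $\phi_j\in\mathbb{P}_k$, $\phi_i(x_j)=\delta_{ij}$, the set of nodes being invariant under the affine symmetries of $K$ and having exactly $k+1$ members on each edge of $K$. Fix also a shape-regularity constant $\sigma$. Consider finite conforming triangulations $\widetilde{\mathcal T}_h$ of closed polyhedral surfaces $\Gamma_h$ (each edge lies in exactly two triangles) into nondegenerate triangles whose vertices lie on $\Gamma$, such that every triangle has diameter at most $\sigma$ times the diameter of its inscribed circle. The mesh size $h$ is the maximal diameter of the triangles. For $\widetilde K\in\widetilde{\mathcal T}_h$ with affine parametrization $L:K\to\widetilde K$ put $$F=\sum_j \pi(L(x_j))\,\phi_j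 ,\qquad \widehat K=F(K),\qquad \widehat K^{\ell}=\pi(\widehat K).$$ The curved triangles $\widehat K$ form the Lagrange interpolant $\Gamma_h^k$ of $\Gamma$ of degree $k$. For a point of an element $\widehat K$ let $\nu_h$ be the unit normal of $\widehat K$ pointing to the side of increasing $d$ (i.e. $\nu_h\cdot\nu\ge 0$), $P_h=I-\nu_h\otimes\nu_h$, and let $\delta_h$ be the ratio of the area elements of $\widehat K^\ell$ and $\widehat K$ (computed from the parametrizations $\pi\circ F$ and $F$). For a point of an edge $\hat e$ of $\widehat K$ (image of an edge of $K$) let $\delta_{\hat e}$ be the ratio of the length elements of $\pi(\hat e)$ and $\hat e$, let $n_h$ be the outer unit conormal of $\widehat K$ along $\hat e$ and $n$ the outer unit conormal of $\widehat K^\ell$ along $\pi(\hat e)$: the unit vector tangent to the element that is orthogonal to the edge and points out of the element. Put $$R_h=\tfrac1{\delta_h}P(I-dH)P_h(I-dH)P,\qquad R_{\hat e}=\tfrac1{\delta_{\hat e}}P(I-dH)P_h(I-dH)P .$$ Then there are constants $C>0$ and $h_0>0$, depending only on $\Gamma$ (with its orientation), $k$, the Lagrange element and $\sigma$, such that for all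 such triangulations with $h\le h_0$: at all points of every element $\widehat K$ of $\Gamma_h^k$, $$|d|\le Ch^{k+1},\qquad |1-\delta_h|\le Ch^{k+1},\qquad |\nu-\nu_h|\le Ch^{k},\qquad \|P-R_h\|\le Ch^{k+1};$$ at all points of every edge $\hat e$ of every element $\widehat K$ of $\Gamma_h^k$ (hence, on an edge common to two elements $\widehat K^{\pm}$, from both sides, with $n=n^\pm$ and $n_h=n_h^\pm$), $$|1-\delta_{\hat e}|\le Ch^{k+1},\qquad \|P-R_{\hat e}\|\le Ch^{k+1},\qquad |n-Pn_h|\le Ch^{k+1}.$$ Here $d,\nu,P,H$ are evaluated at the point of $\Gamma_h^k$, $n$ is evaluated at its projection under $\pi$, and $\|\cdot\|$ is the operator norm. -/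

import Mathlib

noncomputable section

namespace SurfaceDG

/-- Euclidean three-space. -/
abbrev E3 : Type := EuclideanSpace ℝ (Fin 3)

/-! ### The smooth surface, its signed distance and its closest point projection -/

/-- `Γ` is a smooth embedded surface without boundary, oriented by the unit normal field `ν`:
near each of its points `Γ` is the zero set of a smooth function `f` with nonvanishing gradient
and `ν = ∇f / ‖∇f‖` on `Γ`. Only the values of `ν` on `Γ` matter. -/
structure IsOrientedSmoothSurface (Γ : Set E3) (ν : E3 → E3) : Prop where
  exists_local_equation : ∀ p ∈ Γ, ∃ (V : Set E3) (f : E3 → ℝ),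
    IsOpen V ∧ p ∈ V ∧ ContDiffOn ℝ ((⊤ : ℕ∞) : WithTop ℕ∞) f V ∧
    Γ ∩ V = {x | x ∈ V ∧ f x = 0} ∧
    ∀ x ∈ Γ ∩ V, gradient f x ≠ 0 ∧ ν x = ‖gradient f x‖⁻¹ • gradient f x

/-- `p` is a point of `Γ` nearest to `x`. -/
def IsNearestPoint (Γ : Set E3) (x p : E3) : Prop :=
  p ∈ Γ ∧ dist x p = Metric.infDist x Γ

/-- The closest point projection `π` onto `Γ`. On a thin tube around a compact smooth surface the
nearest point is unique, so that no choice is made there. -/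
def closestPoint (Γ : Set E3) (x : E3) : E3 :=
  Classical.epsilon (IsNearestPoint Γ x)

/-- The signed distance `d` to `Γ`, positive on the side to which `ν` points. -/
def signedDistance (Γ : Set E3) (ν : E3 → E3) (x : E3) : ℝ :=
  open Classical in
  if 0 ≤ inner ℝ (x - closestPoint Γ x) (ν (closestPoint Γ x)) then Metric.infDist x Γ
  else -Metric.infDist x Γ

/-- The normal of `Γ`, extended to the tube by `ν(x) = ν(π(x))`. -/
def surfaceNormal (Γ : Set E3) (ν : E3 → E3) (x : E3) : E3 := ν (closestPoint Γ x)

/-- `H = ∇²d`, as a linear map. -/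
def distanceHessian (Γ : Set E3) (ν : E3 → E3) (x : E3) : E3 →L[ℝ] E3 :=
  fderiv ℝ (gradient (signedDistance Γ ν)) x

/-- `I - n ⊗ n`. -/
def tangentialProjection (n : E3) : E3 →L[ℝ] E3 :=
  ContinuousLinearMap.id ℝ E3 - InnerProductSpace.rankOne ℝ n n

/-! ### The reference triangle and Lagrange elements -/

/-- Barycentric coordinates with respect to the reference triangle with vertices
`(0,0)`, `(1,0)`, `(0,1)`. -/
def bary (x : Fin 2 → ℝ) : Fin 3 → ℝ := ![1 - x 0 - x 1, x 0, x 1]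

/-- The linear part of `bary`. -/
def baryDir (v : Fin 2 → ℝ) : Fin 3 → ℝ := ![-v 0 - v 1, v 0, v 1]

/-- The vertices of the reference triangle. -/
def refVertex : Fin 3 → Fin 2 → ℝ := ![![0, 0], ![1, 0], ![0, 1]]

/-- The closed reference triangle. -/
def refTriangle : Set (Fin 2 → ℝ) := {x | ∀ i, 0 ≤ bary x i}

/-- The closed edge of the reference triangle opposite to the vertex `i`. -/
def refEdge (i : Fin 3) : Set (Fin 2 → ℝ) := {x | x ∈ refTriangle ∧ bary x i = 0}

/-- The derivative of the affine parametrization over `[0,1]` of the edge opposite to `i`. -/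
def edgeDir (i : Fin 3) : Fin 2 → ℝ := refVertex (i + 2) - refVertex (i + 1)

/-- A conforming Lagrange element of degree `k` on the reference triangle: as many nodes as
`dim ℙ_k = (k+1)(k+2)/2`, with their Lagrange basis in `ℙ_k`. The node set is invariant under
the symmetries of the triangle and has `k + 1` members on each edge (so elementwise interpolation
is continuous across edges and does not depend on the labelling of the vertices). -/
structure LagrangeElement (k : ℕ) where
  node : Fin ((k + 1) * (k + 2) / 2) → Fin 2 → ℝ
  basis : Fin ((k + 1) * (k + 2) / 2) → MvPolynomial (Fin 2) ℝ
  node_mem : ∀ j, node j ∈ refTriangle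
  basis_degree : ∀ j, (basis j).totalDegree ≤ k
  basis_node : ∀ i j, MvPolynomial.eval (node j) (basis i) = if i = j then 1 else 0
  node_symm : ∀ (σ : Equiv.Perm (Fin 3)) (j), ∃ l, bary (node l) = bary (node j) ∘ σ
  node_edge : ∀ i : Fin 3, {j | bary (node j) i = 0}.ncard = k + 1

/-! ### Polyhedral surfaces inscribed in `Γ` -/

/-- `T` is a finite conforming triangulation of a closed polyhedral surface with vertices on `Γ`:
every simplex lies in a triangle and every edge is common to exactly two triangles. -/
structure IsInscribedTriangulation (Γ : Set E3) (T : Geometry.SimplicialComplex ℝ E3) : Prop where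
  finite : T.faces.Finite
  vertices_mem : ∀ s ∈ T.faces, (s : Set E3) ⊆ Γ
  pure_two : ∀ s ∈ T.faces, ∃ t ∈ T.faces, s ⊆ t ∧ t.card = 3
  closed : ∀ e ∈ T.faces, e.card = 2 → {t | t ∈ T.faces ∧ e ⊆ t ∧ t.card = 3}.ncard = 2

/-- `a` lists the three vertices of a triangle of `T`. -/
def IsElement (T : Geometry.SimplicialComplex ℝ E3) (a : Fin 3 → E3) : Prop :=
  Function.Injective a ∧ ∃ t ∈ T.faces, (t : Set E3) = Set.range a

/-- The diameter of the flat triangle with vertices `a`. -/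
def triDiam (a : Fin 3 → E3) : ℝ := Metric.diam (convexHull ℝ (Set.range a))

/-- The area of the parallelogram spanned by `u` and `v`. -/
def parallelogramArea (u v : E3) : ℝ := Real.sqrt (‖u‖ ^ 2 * ‖v‖ ^ 2 - (inner ℝ u v) ^ 2)

/-- The diameter `4 · area / perimeter` of the inscribed circle of the triangle. -/
def inscribedDiam (a : Fin 3 → E3) : ℝ :=
  4 * (parallelogramArea (a 1 - a 0) (a 2 - a 0) / 2) /
    (dist (a 0) (a 1) + dist (a 1) (a 2) + dist (a 2) (a 0))

/-- Shape regularity with constant `σ`: each triangle has diameter at most `σ` times the diameter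
of its inscribed circle. -/
def IsShapeRegular (σ : ℝ) (T : Geometry.SimplicialComplex ℝ E3) : Prop :=
  ∀ a, IsElement T a → triDiam a ≤ σ * inscribedDiam a

/-- The mesh size `h`: the largest diameter of a simplex of `T`. -/
def meshSize (T : Geometry.SimplicialComplex ℝ E3) : ℝ :=
  sSup ((fun s : Finset E3 => Metric.diam (convexHull ℝ (s : Set E3))) '' T.faces)

/-! ### The curved elements of `Γ_h^k` and their lifts to `Γ` -/

/-- The affine map of the reference triangle onto the flat triangle with vertices `a`. -/
def flatMap (a : Fin 3 → E3) (x : Fin 2 → ℝ) : E3 := ∑ i, bary x i • a i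

/-- The parametrization of a curved element of `Γ_h^k` over the reference triangle: the flat
parametrization followed by the degree `k` Lagrange interpolant of `π`. -/
def elementMap {k : ℕ} (Γ : Set E3) (N : LagrangeElement k) (a : Fin 3 → E3)
    (x : Fin 2 → ℝ) : E3 :=
  ∑ j, MvPolynomial.eval x (N.basis j) • closestPoint Γ (flatMap a (N.node j))

/-- The parametrization of the lifted element on `Γ`. -/
def liftMap {k : ℕ} (Γ : Set E3) (N : LagrangeElement k) (a : Fin 3 → E3)
    (x : Fin 2 → ℝ) : E3 :=
  closestPoint Γ (elementMap Γ N a x)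

/-- The area element `‖∂₁F × ∂₂F‖` of a parametrization with derivative `A`. -/
def areaElement (A : (Fin 2 → ℝ) →L[ℝ] E3) : ℝ :=
  parallelogramArea (A (Pi.single 0 1)) (A (Pi.single 1 1))

/-- The local area deformation `δ_h = dA / dA_hk` at the point with parameter `x`. -/
def areaDeformation {k : ℕ} (Γ : Set E3) (N : LagrangeElement k) (a : Fin 3 → E3)
    (x : Fin 2 → ℝ) : ℝ :=
  areaElement (fderiv ℝ (liftMap Γ N a) x) / areaElement (fderiv ℝ (elementMap Γ N a) x)

/-- The local edge deformation `δ_e = ds / ds_hk` along the edge opposite to vertex `i`, at the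
point with parameter `x`. -/
def edgeDeformation {k : ℕ} (Γ : Set E3) (N : LagrangeElement k) (a : Fin 3 → E3) (i : Fin 3)
    (x : Fin 2 → ℝ) : ℝ :=
  ‖fderiv ℝ (liftMap Γ N a) x (edgeDir i)‖ / ‖fderiv ℝ (elementMap Γ N a) x (edgeDir i)‖

/-- `n` is a unit normal `ν_h` of the curved element at the point with parameter `x`, on the side
of increasing signed distance (the orientation of `Γ`). -/
def IsDiscreteNormal {k : ℕ} (Γ : Set E3) (ν : E3 → E3) (N : LagrangeElement k) (a : Fin 3 → E3)
    (x : Fin 2 → ℝ) (n : E3) : Prop :=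
  ‖n‖ = 1 ∧ (∀ v, inner ℝ n (fderiv ℝ (elementMap Γ N a) x v) = 0) ∧
    0 ≤ inner ℝ n (surfaceNormal Γ ν (elementMap Γ N a x))

/-- For a parametrization with derivative `A` at a point of the edge opposite to vertex `i`: `n` is
the outer unit conormal, i.e. a unit tangent vector of the element which makes a nonpositive inner
product with all tangent vectors pointing into the element (hence is orthogonal to the edge). -/
def IsOuterConormal (A : (Fin 2 → ℝ) →L[ℝ] E3) (i : Fin 3) (n : E3) : Prop :=
  ‖n‖ = 1 ∧ n ∈ Set.range A ∧ ∀ v, 0 ≤ baryDir v i → inner ℝ n (A v) ≤ 0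

/-- `δ⁻¹ P (I - d H) P_h (I - d H) P` at the point `y`, where `P_h = I - n ⊗ n`. -/
def deformationTensor (Γ : Set E3) (ν : E3 → E3) (y : E3) (δ : ℝ) (n : E3) : E3 →L[ℝ] E3 :=
  δ⁻¹ • (tangentialProjection (surfaceNormal Γ ν y) ∘L
    (ContinuousLinearMap.id ℝ E3 - signedDistance Γ ν y • distanceHessian Γ ν y) ∘L
    tangentialProjection n ∘L
    (ContinuousLinearMap.id ℝ E3 - signedDistance Γ ν y • distanceHessian Γ ν y) ∘L
    tangentialProjection (surfaceNormal Γ ν y))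

end SurfaceDG

end

open SurfaceDG

/-!
The closest point projection `π` turns the whole lemma into an interpolation estimate. Near a point
`p ∈ Γ` with local equation `f = 0`, Lagrange multipliers show that `x` and its foot point satisfy
`x = π x + t ∇f(π x)`, and `(y, t) ↦ (y + t ∇f(y), f(y))` is invertible near `(p, 0)`
(`exists_local_inverse_normal`). So `π`, the extended normal and the signed distance are smooth
there; `Dπ` takes values in the tangent plane and is the tangential projection `P` on `Γ`, hence
equals `P + O(|d|)` nearby. Compactness makes this uniform on a tube (`exists_isTube`).

The curved element is parametrized by the interpolant `F` of `π ∘ L`, with `L` affine. A Lagrange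
element reproduces polynomials of degree `k` (`lagrange_reproduces`), so expanding the nodal values
`π (L x_j)` about `L x` leaves only Taylor remainders: `F - π ∘ L` and `DF - D(π ∘ L)` are
`O(h ^ (k + 1))` (`norm_interpolant_sub_le`, `norm_fderiv_interpolant_sub_le`). The first bound
gives `|d| = O(h ^ (k + 1))`. Since `D(π ∘ L)` is tangential to `Γ` and shape regularity gives
`‖DF v‖ ≥ c h ‖v‖`, the second one says that unit tangent vectors of the curved element have normal
component `ε = O(h ^ k)` (`exists_isCurvedElementEstimate`).

The rest is linear algebra. The lift has derivative `Dπ ∘ DF`, where `Dπ = P + O(h ^ (k + 1))`, and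
`P` changes inner products of such tangent vectors only by `O(ε ^ 2)`. As `2 k ≥ k + 1`, lengths,
areas, angles and conormals are preserved up to `O(h ^ (k + 1))` (`IsAlmostProjection` and the
lemmas about it), whereas the normals, which see `ε` itself, are only `O(h ^ k)` apart.
-/

noncomputable section

namespace SurfaceDG

open Filter Topology

/-! ### Taylor's formula along segments -/

/-- Along a segment the `m`-th derivative of `f` is `D^m f` applied to `m` copies of the
direction. -/
lemma iteratedDerivWithin_along_segment {E G : Type*} [NormedAddCommGroup E] [NormedSpace ℝ E]
    [NormedAddCommGroup G] [NormedSpace ℝ G] {f : E → G} {x e : E} {n : ℕ}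
    (hf : ∀ t ∈ Set.Icc (0 : ℝ) 1, ContDiffAt ℝ n f (x + t • e)) {m : ℕ} (hm : m ≤ n) :
    ∀ t ∈ Set.Icc (0 : ℝ) 1, iteratedDerivWithin m (fun t : ℝ => f (x + t • e)) (Set.Icc 0 1) t =
      iteratedFDeriv ℝ m f (x + t • e) (fun _ => e) := by
  induction m with
  | zero => intro t _; simp
  | succ m ih =>
    intro t ht
    have ih := ih (by omega)
    have hu : UniqueDiffWithinAt ℝ (Set.Icc (0 : ℝ) 1) t := uniqueDiffOn_Icc one_pos t ht
    rw [iteratedDerivWithin_succ, derivWithin_congr ih (ih t ht)]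
    have h1 : DifferentiableAt ℝ (iteratedFDeriv ℝ m f) (x + t • e) :=
      (hf t ht).differentiableAt_iteratedFDeriv (by exact_mod_cast hm)
    have h2 : HasDerivAt (fun t : ℝ => x + t • e) e t := by
      simpa using ((hasDerivAt_id t).smul_const e).const_add x
    have h3 := (h1.hasFDerivAt.comp_hasDerivAt t h2)
    have h4 := ((ContinuousMultilinearMap.apply ℝ (fun _ : Fin m => E) G
      (fun _ => e)).hasFDerivAt).comp_hasDerivAt t h3
    have h5 := h4.hasDerivWithinAt (s := Set.Icc (0:ℝ) 1)
    refine (h5.derivWithin hu).trans ?_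
    rw [iteratedFDeriv_succ_apply_left]
    rfl

/-- Taylor's formula in several variables, without the factorial in the remainder. -/
lemma norm_sub_taylor_le {E G : Type*} [NormedAddCommGroup E] [NormedSpace ℝ E]
    [NormedAddCommGroup G] [NormedSpace ℝ G] {f : E → G} {x e : E} {n : ℕ} {M : ℝ}
    (hf : ∀ t ∈ Set.Icc (0 : ℝ) 1, ContDiffAt ℝ (n + 1 : ℕ) f (x + t • e))
    (hM : ∀ t ∈ Set.Icc (0 : ℝ) 1, ‖iteratedFDeriv ℝ (n + 1) f (x + t • e)‖ ≤ M) :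
    ‖f (x + e) - ∑ m ∈ Finset.range (n + 1),
      (m.factorial : ℝ)⁻¹ • iteratedFDeriv ℝ m f x (fun _ => e)‖ ≤ M * ‖e‖ ^ (n + 1) := by
  have hφ : ContDiffOn ℝ (n + 1 : ℕ) (fun t : ℝ => f (x + t • e)) (Set.Icc 0 1) := by
    intro t ht
    have : ContDiffAt ℝ (n + 1 : ℕ) (fun t : ℝ => x + t • e) t := by fun_prop
    exact ((hf t ht).comp t this).contDiffWithinAt
  have key := taylor_mean_remainder_bound (f := fun t : ℝ => f (x + t • e)) (a := 0) (b := 1)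
    (C := M * ‖e‖ ^ (n + 1)) (x := 1) (n := n) zero_le_one
    (by exact_mod_cast hφ) (by simp) (by
      intro t ht
      rw [iteratedDerivWithin_along_segment hf le_rfl t ht]
      refine (ContinuousMultilinearMap.le_opNorm _ _).trans ?_
      simp only [Finset.prod_const, Finset.card_univ, Fintype.card_fin]
      gcongr
      exact hM t ht)
  rw [taylor_within_apply] at key
  have h0 : (0:ℝ) ∈ Set.Icc (0:ℝ) 1 := by simp
  have e1 : ∀ m ∈ Finset.range (n + 1),
      iteratedDerivWithin m (fun t : ℝ => f (x + t • e)) (Set.Icc 0 1) 0 =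
      iteratedFDeriv ℝ m f x (fun _ => e) := fun m hm => by
    simpa using iteratedDerivWithin_along_segment hf (Finset.mem_range.1 hm).le 0 h0
  simp only [sub_zero, one_pow, mul_one, one_smul] at key
  rw [Finset.sum_congr rfl fun m hm => by rw [e1 m hm]] at key
  have hM0 : 0 ≤ M * ‖e‖ ^ (n + 1) :=
    mul_nonneg ((norm_nonneg _).trans (hM 0 h0)) (by positivity)
  refine key.trans (div_le_self hM0 ?_)
  exact_mod_cast Nat.one_le_iff_ne_zero.2 n.factorial_ne_zero

/-! ### Polynomial reproduction by a Lagrange element -/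

/-- The monomials `X ^ a * Y ^ b` with `a + b ≤ k` span the polynomials of degree at most `k`. -/
lemma exists_finset_span_restrictTotalDegree (k : ℕ) :
    ∃ S : Finset (MvPolynomial (Fin 2) ℝ), S.card ≤ (k + 1) * (k + 2) / 2 ∧
      MvPolynomial.restrictTotalDegree (Fin 2) ℝ k ≤ Submodule.span ℝ (S : Set _) := by
  classical
  let I : Finset (ℕ × ℕ) := (Finset.range (k + 1)).biUnion fun n =>
    Finset.HasAntidiagonal.antidiagonal n
  let mon : ℕ × ℕ → MvPolynomial (Fin 2) ℝ := fun q =>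
    MvPolynomial.X 0 ^ q.1 * MvPolynomial.X 1 ^ q.2
  have hI : I.card ≤ (k + 1) * (k + 2) / 2 := by
    refine Finset.card_biUnion_le.trans (le_of_eq ?_)
    simp only [Finset.Nat.card_antidiagonal]
    have := Finset.sum_range_id_mul_two (k + 2)
    rw [Finset.sum_range_succ'] at this
    simp only [add_zero] at this
    have h2 : (k + 2) * (k + 2 - 1) = (k + 1) * (k + 2) := mul_comm _ _
    omega
  refine ⟨I.image mon, Finset.card_image_le.trans hI, fun p hp => ?_⟩
  rw [MvPolynomial.mem_restrictTotalDegree] at hp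
  rw [p.as_sum]
  refine Submodule.sum_mem _ fun s hs => ?_
  have h1 := (MvPolynomial.le_totalDegree hs).trans hp
  rw [Finsupp.sum_fintype _ _ (by simp), Fin.sum_univ_two] at h1
  have h2 : MvPolynomial.monomial s (MvPolynomial.coeff s p) =
      MvPolynomial.coeff s p • mon (s 0, s 1) := by
    rw [MvPolynomial.monomial_eq, Finsupp.prod_fintype _ _ (by simp), Fin.prod_univ_two,
      MvPolynomial.smul_eq_C_mul]
  rw [h2]
  refine Submodule.smul_mem _ _ (Submodule.subset_span ?_)
  rw [Finset.mem_coe]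
  refine Finset.mem_image_of_mem _ ?_
  simp only [I, Finset.mem_biUnion, Finset.mem_range]
  exact ⟨s 0 + s 1, by omega, Finset.HasAntidiagonal.mem_antidiagonal.2 rfl⟩

/-- A Lagrange element interpolates every polynomial of degree at most `k` exactly: its basis is
linearly independent by duality with the nodes, and there are as many basis functions as the
dimension allows. -/
lemma lagrange_reproduces {k : ℕ} (N : LagrangeElement k) {p : MvPolynomial (Fin 2) ℝ}
    (hp : p.totalDegree ≤ k) (y : Fin 2 → ℝ) :
    ∑ j, MvPolynomial.eval y (N.basis j) * MvPolynomial.eval (N.node j) p =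
      MvPolynomial.eval y p := by
  classical
  let W := MvPolynomial.restrictTotalDegree (Fin 2) ℝ k
  let b : Fin ((k + 1) * (k + 2) / 2) → W := fun j =>
    ⟨N.basis j, (MvPolynomial.mem_restrictTotalDegree _ _ _).2 (N.basis_degree j)⟩
  have hev : ∀ (c : Fin ((k + 1) * (k + 2) / 2) → ℝ) (q : MvPolynomial (Fin 2) ℝ),
      q = ∑ j, c j • N.basis j → ∀ i, MvPolynomial.eval (N.node i) q = c i := by
    rintro c q rfl i
    simp [map_sum, MvPolynomial.smul_eval, N.basis_node]
  have hli : LinearIndependent ℝ b := by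
    rw [Fintype.linearIndependent_iff]
    intro c hc i
    have h1 : (0 : MvPolynomial (Fin 2) ℝ) = ∑ j, c j • N.basis j := by
      have := congrArg Subtype.val hc
      simpa [b] using this.symm
    have := hev c 0 h1 i
    simpa using this.symm
  obtain ⟨S, hS, hle⟩ := exists_finset_span_restrictTotalDegree k
  have hfS := FiniteDimensional.span_finset ℝ S
  have hfd : Module.Finite ℝ W := Submodule.finiteDimensional_of_le hle
  have hspan : Submodule.span ℝ (Set.range b) = ⊤ := by
    refine hli.span_eq_top_of_card_eq_finrank' ?_
    refine le_antisymm hli.fintype_card_le_finrank ?_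
    rw [Fintype.card_fin]
    exact (Submodule.finrank_mono hle).trans ((finrank_span_finset_le_card S).trans hS)
  have hmem : (⟨p, (MvPolynomial.mem_restrictTotalDegree _ _ _).2 hp⟩ : W) ∈
      Submodule.span ℝ (Set.range b) := hspan ▸ Submodule.mem_top
  obtain ⟨c, hc⟩ := (Submodule.mem_span_range_iff_exists_fun ℝ).1 hmem
  have hc' : p = ∑ j, c j • N.basis j := by
    have := congrArg Subtype.val hc
    simpa [b] using this.symm
  have h2 := hev c p hc'
  simp only [h2]
  conv_rhs => rw [hc']
  simp [map_sum, MvPolynomial.smul_eval, mul_comm]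

/-! ### Interpolation error on an element -/

/-- The derivative of the affine parametrization `flatMap a`. -/
def flatDeriv (a : Fin 3 → E3) : (Fin 2 → ℝ) →L[ℝ] E3 :=
  (ContinuousLinearMap.proj 0).smulRight (a 1 - a 0) +
    (ContinuousLinearMap.proj 1).smulRight (a 2 - a 0)

lemma flatDeriv_apply (a : Fin 3 → E3) (v : Fin 2 → ℝ) :
    flatDeriv a v = v 0 • (a 1 - a 0) + v 1 • (a 2 - a 0) := rfl

lemma flatMap_sub (a : Fin 3 → E3) (z x : Fin 2 → ℝ) :
    flatMap a z - flatMap a x = flatDeriv a (z - x) := by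
  simp only [flatMap, bary, Fin.sum_univ_three, flatDeriv_apply, Pi.sub_apply, Matrix.cons_val]
  module

lemma convex_refTriangle : Convex ℝ refTriangle := by
  intro x hx y hy s t hs ht hst i
  have h : bary (s • x + t • y) i = s * bary x i + t * bary y i := by
    (fin_cases i <;> simp [bary]); linear_combination -(1:ℝ) * hst
  rw [h]
  exact add_nonneg (mul_nonneg hs (hx i)) (mul_nonneg ht (hy i))

lemma isCompact_refTriangle : IsCompact refTriangle := by
  refine Metric.isCompact_of_isClosed_isBounded ?_ ?_
  · have : refTriangle = ⋂ i, {x | 0 ≤ bary x i} := by ext; simp [refTriangle]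
    rw [this]
    refine isClosed_iInter fun i => isClosed_le continuous_const ?_
    fin_cases i <;> simp [bary] <;> fun_prop
  · refine (Metric.isBounded_Icc (0 : Fin 2 → ℝ) 1).subset fun x hx => ?_
    have h0 := hx 0
    have h1 := hx 1
    have h2 := hx 2
    simp only [bary, Matrix.cons_val] at h0 h1 h2
    constructor <;> intro i <;> fin_cases i <;> simp <;> linarith

/-- The Taylor terms of degree at most `k` of a function on the flat element are polynomials, hence
are reproduced by the Lagrange element. -/
lemma lagrange_reproduces_multilinear {k : ℕ} (N : LagrangeElement k) (a : Fin 3 → E3) {m : ℕ}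
    (hm : m ≤ k) (D : E3 [×m]→L[ℝ] E3) (x y : Fin 2 → ℝ) :
    ∑ j, MvPolynomial.eval y (N.basis j) • D (fun _ => flatDeriv a (N.node j - x)) =
      D (fun _ => flatDeriv a (y - x)) := by
  classical
  let w : Fin 2 → E3 := ![a 1 - a 0, a 2 - a 0]
  let c : (Fin m → Fin 2) → MvPolynomial (Fin 2) ℝ := fun r =>
    ∏ l, (MvPolynomial.X (r l) - MvPolynomial.C (x (r l)))
  have hc : ∀ r, (c r).totalDegree ≤ k := fun r => by
    refine (MvPolynomial.totalDegree_finsetProd _ _).trans (le_trans ?_ hm)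
    refine (Finset.sum_le_card_nsmul _ _ 1 fun l _ => ?_).trans (by simp)
    exact (MvPolynomial.totalDegree_sub_C_le _ _).trans (MvPolynomial.totalDegree_X _).le
  have hD : ∀ z : Fin 2 → ℝ, D (fun _ => flatDeriv a (z - x)) =
      ∑ r : Fin m → Fin 2, MvPolynomial.eval z (c r) • D (fun l => w (r l)) := fun z => by
    have h1 : (fun _ : Fin m => flatDeriv a (z - x)) =
        fun _ : Fin m => ∑ i : Fin 2, (z i - x i) • w i := by
      simp [flatDeriv_apply, Fin.sum_univ_two, w]
    rw [h1, ContinuousMultilinearMap.map_sum]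
    refine Finset.sum_congr rfl fun r _ => ?_
    rw [ContinuousMultilinearMap.map_smul_univ]
    simp [c, map_prod]
  simp only [hD, Finset.smul_sum, smul_smul]
  rw [Finset.sum_comm]
  refine Finset.sum_congr rfl fun r _ => ?_
  rw [← Finset.sum_smul, lagrange_reproduces N (hc r)]

lemma contDiff_eval (p : MvPolynomial (Fin 2) ℝ) {n : WithTop ℕ∞} :
    ContDiff ℝ n fun y : Fin 2 → ℝ => MvPolynomial.eval y p :=
  (AnalyticOnNhd.eval_mvPolynomial (𝕜 := ℝ) p).contDiff

/-- The Lagrange interpolant of `f` on the flat element with vertices `a`. -/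
def interpolant {k : ℕ} (N : LagrangeElement k) (a : Fin 3 → E3) (f : E3 → E3)
    (x : Fin 2 → ℝ) : E3 :=
  ∑ j, MvPolynomial.eval x (N.basis j) • f (flatMap a (N.node j))

lemma hasFDerivAt_sum_basis {k : ℕ} (N : LagrangeElement k)
    (c : Fin ((k + 1) * (k + 2) / 2) → E3) (x : Fin 2 → ℝ) :
    HasFDerivAt (fun y => ∑ j, MvPolynomial.eval y (N.basis j) • c j)
      (∑ j, (fderiv ℝ (fun y => MvPolynomial.eval y (N.basis j)) x).smulRight (c j)) x := by
  refine HasFDerivAt.fun_sum fun j _ => ?_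
  exact (((contDiff_eval (N.basis j) (n := 1)).differentiable one_ne_zero x).hasFDerivAt).smul_const
    (c j)

/-- The derivative of polynomial reproduction, at the centre `x` of the Taylor terms: only the term
of degree `m = 1` survives, the factor `m * 0 ^ (m - 1)` being `1` there and `0` otherwise. -/
lemma sum_fderiv_basis_smul_multilinear {k : ℕ} (N : LagrangeElement k) (a : Fin 3 → E3) {m : ℕ}
    (hm : m ≤ k) (D : E3 [×m]→L[ℝ] E3) (x v : Fin 2 → ℝ) :
    ∑ j, fderiv ℝ (fun y => MvPolynomial.eval y (N.basis j)) x v •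
        D (fun _ => flatDeriv a (N.node j - x)) =
      ((m : ℝ) * 0 ^ (m - 1)) • D (fun _ => flatDeriv a v) := by
  have h1 := hasFDerivAt_sum_basis N (fun j => D (fun _ => flatDeriv a (N.node j - x))) x
  simp only [lagrange_reproduces_multilinear N a hm D x] at h1
  have h2 : HasDerivAt (fun s : ℝ => x + s • v) v 0 := by
    simpa using ((hasDerivAt_id (0 : ℝ)).smul_const v).const_add x
  have h3 := HasFDerivAt.comp_hasDerivAt_of_eq (0 : ℝ) h1 h2 (by simp)
  have h4 : HasDerivAt (fun s : ℝ => s ^ m • D (fun _ => flatDeriv a v))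
      (((m : ℝ) * 0 ^ (m - 1)) • D (fun _ => flatDeriv a v)) 0 :=
    (hasDerivAt_pow m (0 : ℝ)).smul_const _
  have h5 : (fun y => D (fun _ => flatDeriv a (y - x))) ∘ (fun s : ℝ => x + s • v) =
      fun s : ℝ => s ^ m • D (fun _ => flatDeriv a v) := by
    funext s
    have := D.map_smul_univ (fun _ => s) (fun _ => flatDeriv a v)
    simpa using this
  rw [h5] at h3
  simpa using h3.unique h4

section
variable {k : ℕ} (N : LagrangeElement k) (a : Fin 3 → E3) {f : E3 → E3} {M h : ℝ}
  {x : Fin 2 → ℝ}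

lemma norm_sub_taylor_flatMap_le {z : Fin 2 → ℝ}
    (hf : ∀ z ∈ refTriangle, ContDiffAt ℝ (k + 1 : ℕ) f (flatMap a z))
    (hM : ∀ z ∈ refTriangle, ‖iteratedFDeriv ℝ (k + 1) f (flatMap a z)‖ ≤ M)
    (hh : ∀ z ∈ refTriangle, ‖flatMap a z - flatMap a x‖ ≤ h)
    (hx : x ∈ refTriangle) (hz : z ∈ refTriangle) :
    ‖f (flatMap a z) - ∑ m ∈ Finset.range (k + 1), (m.factorial : ℝ)⁻¹ •
      iteratedFDeriv ℝ m f (flatMap a x) (fun _ => flatDeriv a (z - x))‖ ≤ M * h ^ (k + 1) := by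
  have hseg : ∀ t ∈ Set.Icc (0 : ℝ) 1, flatMap a x + t • flatDeriv a (z - x) =
      flatMap a (x + t • (z - x)) ∧ x + t • (z - x) ∈ refTriangle := fun t ht => by
    refine ⟨?_, convex_refTriangle.add_smul_sub_mem hx hz ht⟩
    rw [sub_eq_iff_eq_add'.1 (flatMap_sub a (x + t • (z - x)) x), add_sub_cancel_left, map_smul]
  have hM0 : 0 ≤ M := (norm_nonneg _).trans (hM x hx)
  have key := norm_sub_taylor_le (f := f) (x := flatMap a x) (e := flatDeriv a (z - x)) (n := k)
    (M := M) (fun t ht => by rw [(hseg t ht).1]; exact hf _ (hseg t ht).2)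
    (fun t ht => by rw [(hseg t ht).1]; exact hM _ (hseg t ht).2)
  have hz' : flatMap a x + flatDeriv a (z - x) = flatMap a z :=
    (sub_eq_iff_eq_add'.1 (flatMap_sub a z x)).symm
  rw [hz'] at key
  refine key.trans ?_
  rw [← flatMap_sub]
  gcongr
  exact hh z hz

/-- The interpolation error at `x`: the Taylor polynomials of the nodal values about `flatMap a x`
are interpolated exactly, with value `f (flatMap a x)` at `x`, so only the remainders contribute. -/
lemma norm_interpolant_sub_le
    (hf : ∀ z ∈ refTriangle, ContDiffAt ℝ (k + 1 : ℕ) f (flatMap a z))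
    (hM : ∀ z ∈ refTriangle, ‖iteratedFDeriv ℝ (k + 1) f (flatMap a z)‖ ≤ M)
    (hh : ∀ z ∈ refTriangle, ‖flatMap a z - flatMap a x‖ ≤ h) (hx : x ∈ refTriangle) :
    ‖interpolant N a f x - f (flatMap a x)‖ ≤
      (∑ j, |MvPolynomial.eval x (N.basis j)|) * (M * h ^ (k + 1)) := by
  set q : (Fin 2 → ℝ) → E3 := fun z => ∑ m ∈ Finset.range (k + 1), (m.factorial : ℝ)⁻¹ •
      iteratedFDeriv ℝ m f (flatMap a x) (fun _ => flatDeriv a (z - x)) with hq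
  have h1 : ∑ j, MvPolynomial.eval x (N.basis j) • q (N.node j) = f (flatMap a x) := by
    simp only [hq, Finset.smul_sum]
    rw [Finset.sum_comm]
    have : ∀ m ∈ Finset.range (k + 1), ∑ j, MvPolynomial.eval x (N.basis j) •
        (m.factorial : ℝ)⁻¹ • iteratedFDeriv ℝ m f (flatMap a x)
          (fun _ => flatDeriv a (N.node j - x)) =
        (m.factorial : ℝ)⁻¹ • iteratedFDeriv ℝ m f (flatMap a x)
          (fun _ => flatDeriv a (x - x)) := by
      intro m hm
      rw [← lagrange_reproduces_multilinear N a (Finset.mem_range_succ_iff.1 hm), Finset.smul_sum]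
      exact Finset.sum_congr rfl fun j _ => smul_comm _ _ _
    rw [Finset.sum_congr rfl this, Finset.sum_eq_single 0]
    · simp
    · intro m _ hm
      have : Nonempty (Fin m) := ⟨⟨0, Nat.pos_of_ne_zero hm⟩⟩
      rw [sub_self, map_zero]
      rw [(iteratedFDeriv ℝ m f (flatMap a x)).map_coord_zero (Classical.arbitrary _) rfl,
        smul_zero]
    · simp
  rw [← h1, interpolant, ← Finset.sum_sub_distrib, Finset.sum_mul]
  refine (norm_sum_le _ _).trans (Finset.sum_le_sum fun j _ => ?_)
  rw [← smul_sub, norm_smul, Real.norm_eq_abs]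
  gcongr
  exact norm_sub_taylor_flatMap_le a hf hM hh hx (N.node_mem j)

/-- The error of the derivative at `x`: in the same expansion, the derivatives of the basis
functions reproduce the derivative of the Taylor polynomial, which is its linear term. -/
lemma norm_fderiv_interpolant_sub_le (hk : 1 ≤ k)
    (hf : ∀ z ∈ refTriangle, ContDiffAt ℝ (k + 1 : ℕ) f (flatMap a z))
    (hM : ∀ z ∈ refTriangle, ‖iteratedFDeriv ℝ (k + 1) f (flatMap a z)‖ ≤ M)
    (hh : ∀ z ∈ refTriangle, ‖flatMap a z - flatMap a x‖ ≤ h) (hx : x ∈ refTriangle)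
    (v : Fin 2 → ℝ) :
    ‖fderiv ℝ (interpolant N a f) x v - fderiv ℝ f (flatMap a x) (flatDeriv a v)‖ ≤
      (∑ j, ‖fderiv ℝ (fun y => MvPolynomial.eval y (N.basis j)) x‖) * ‖v‖ * (M * h ^ (k + 1)) := by
  set q : (Fin 2 → ℝ) → E3 := fun z => ∑ m ∈ Finset.range (k + 1), (m.factorial : ℝ)⁻¹ •
      iteratedFDeriv ℝ m f (flatMap a x) (fun _ => flatDeriv a (z - x)) with hq
  set ψ := fun j => fderiv ℝ (fun y => MvPolynomial.eval y (N.basis j)) x with hψ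
  have h0 : fderiv ℝ (interpolant N a f) x v = ∑ j, ψ j v • f (flatMap a (N.node j)) := by
    have := (hasFDerivAt_sum_basis N (fun j => f (flatMap a (N.node j))) x).fderiv
    change fderiv ℝ (fun y => ∑ j, MvPolynomial.eval y (N.basis j) • f (flatMap a (N.node j))) x v
      = _
    rw [this]
    simp [hψ]
  have h1 : ∑ j, ψ j v • q (N.node j) = fderiv ℝ f (flatMap a x) (flatDeriv a v) := by
    simp only [hq, Finset.smul_sum]
    rw [Finset.sum_comm]
    have : ∀ m ∈ Finset.range (k + 1), ∑ j, ψ j v •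
        (m.factorial : ℝ)⁻¹ • iteratedFDeriv ℝ m f (flatMap a x)
          (fun _ => flatDeriv a (N.node j - x)) =
        (m.factorial : ℝ)⁻¹ • ((m : ℝ) * 0 ^ (m - 1)) • iteratedFDeriv ℝ m f (flatMap a x)
          (fun _ => flatDeriv a v) := by
      intro m hm
      rw [← sum_fderiv_basis_smul_multilinear N a (Finset.mem_range_succ_iff.1 hm),
        Finset.smul_sum]
      exact Finset.sum_congr rfl fun j _ => smul_comm _ _ _
    rw [Finset.sum_congr rfl this, Finset.sum_eq_single 1]
    · simp
    · intro m _ hm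
      rcases Nat.eq_zero_or_pos m with rfl | hm0
      · simp
      · rw [zero_pow (by omega)]; simp
    · intro h; exact absurd (Finset.mem_range.2 (by omega)) h
  rw [← h1, h0, ← Finset.sum_sub_distrib, Finset.sum_mul, Finset.sum_mul]
  refine (norm_sum_le _ _).trans (Finset.sum_le_sum fun j _ => ?_)
  rw [← smul_sub, norm_smul]
  gcongr
  · exact (ψ j).le_opNorm v
  · exact norm_sub_taylor_flatMap_le a hf hM hh hx (N.node_mem j)

/-- The basis functions and their derivatives are bounded on the reference triangle. -/
lemma exists_basis_bound : ∃ Λ : ℝ, 0 ≤ Λ ∧ ∀ x ∈ refTriangle,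
    ∑ j, |MvPolynomial.eval x (N.basis j)| ≤ Λ ∧
    ∑ j, ‖fderiv ℝ (fun y => MvPolynomial.eval y (N.basis j)) x‖ ≤ Λ := by
  have c1 : Continuous fun x : Fin 2 → ℝ => ∑ j, |MvPolynomial.eval x (N.basis j)| :=
    continuous_finsetSum _ fun j _ => (contDiff_eval (N.basis j) (n := 0)).continuous.abs
  have c2 : Continuous fun x : Fin 2 → ℝ =>
      ∑ j, ‖fderiv ℝ (fun y => MvPolynomial.eval y (N.basis j)) x‖ :=
    continuous_finsetSum _ fun j _ =>
      ((contDiff_eval (N.basis j) (n := 1)).continuous_fderiv one_ne_zero).norm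
  obtain ⟨A, hA⟩ := isCompact_refTriangle.exists_bound_of_continuousOn c1.continuousOn
  obtain ⟨B, hB⟩ := isCompact_refTriangle.exists_bound_of_continuousOn c2.continuousOn
  refine ⟨max 0 (max A B), le_max_left _ _, fun x hx => ⟨?_, ?_⟩⟩
  · exact (le_abs_self _).trans ((hA x hx).trans ((le_max_left _ _).trans (le_max_right _ _)))
  · exact (le_abs_self _).trans ((hB x hx).trans ((le_max_right _ _).trans (le_max_right _ _)))
end

/-! ### The closest point projection near the surface -/

lemma isNearestPoint_closestPoint {Γ : Set E3} (hc : IsCompact Γ) (hne : Γ.Nonempty) (x : E3) :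
    IsNearestPoint Γ x (closestPoint Γ x) := by
  refine Classical.epsilon_spec (p := IsNearestPoint Γ x) ?_
  obtain ⟨p, hp, h⟩ := hc.exists_infDist_eq_dist hne x
  exact ⟨p, hp, h.symm⟩

lemma closestPoint_of_mem {Γ : Set E3} (hc : IsCompact Γ) {p : E3} (hp : p ∈ Γ) :
    closestPoint Γ p = p := by
  have h := (isNearestPoint_closestPoint hc ⟨p, hp⟩ p).2
  rw [Metric.infDist_zero_of_mem hp] at h
  exact (dist_eq_zero.1 h).symm

lemma abs_signedDistance (Γ : Set E3) (ν : E3 → E3) (x : E3) :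
    |signedDistance Γ ν x| = Metric.infDist x Γ := by
  unfold signedDistance
  split_ifs <;> simp [Metric.infDist_nonneg]

lemma dist_closestPoint_le {Γ : Set E3} (hc : IsCompact Γ) {p : E3} (hp : p ∈ Γ) (x : E3) :
    dist (closestPoint Γ x) p ≤ 2 * dist x p := by
  have h := (isNearestPoint_closestPoint hc ⟨p, hp⟩ x).2
  have h2 := Metric.infDist_le_dist_of_mem (x := x) hp
  have h3 := dist_triangle_left (closestPoint Γ x) p x
  linarith

lemma tendsto_closestPoint {Γ : Set E3} (hc : IsCompact Γ) {p : E3} (hp : p ∈ Γ) :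
    Tendsto (closestPoint Γ) (𝓝 p) (𝓝 p) := by
  rw [tendsto_iff_dist_tendsto_zero]
  refine squeeze_zero (fun _ => dist_nonneg) (dist_closestPoint_le hc hp) ?_
  have : Tendsto (fun x => 2 * dist x p) (𝓝 p) (𝓝 (2 * dist p p)) := by
    exact (Continuous.tendsto (by fun_prop) p)
  simpa using this

/-- Lagrange multipliers: the segment from a point to a nearest point of a level set is normal. -/
lemma exists_smul_gradient_of_isNearestPoint {Γ V : Set E3} {f : E3 → ℝ} (hV : IsOpen V)
    (hΓV : Γ ∩ V = {x | x ∈ V ∧ f x = 0}) {x p : E3} (hp : IsNearestPoint Γ x p) (hpV : p ∈ V)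
    (hf : ContDiffAt ℝ 1 f p) (hg : gradient f p ≠ 0) :
    ∃ c : ℝ, x - p = c • gradient f p := by
  have hfp : f p = 0 := by
    have : p ∈ Γ ∩ V := ⟨hp.1, hpV⟩
    rw [hΓV] at this; exact this.2
  have hext : IsLocalExtrOn (fun z => ‖z - x‖ ^ 2) {z | f z = f p} p := by
    left
    filter_upwards [self_mem_nhdsWithin, mem_nhdsWithin_of_mem_nhds (hV.mem_nhds hpV)] with z hz hzV
    have hzΓ : z ∈ Γ ∩ V := by rw [hΓV]; exact ⟨hzV, by rw [← hfp]; exact hz⟩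
    have h1 : dist x p ≤ dist x z := hp.2 ▸ Metric.infDist_le_dist_of_mem hzΓ.1
    rw [dist_comm x p, dist_comm x z, dist_eq_norm, dist_eq_norm] at h1
    gcongr
  have hf' : HasStrictFDerivAt f (fderiv ℝ f p) p := hf.hasStrictFDerivAt one_ne_zero
  have hφ' : HasStrictFDerivAt (fun z => ‖z - x‖ ^ 2) (2 • innerSL ℝ (p - x)) p :=
    (hasStrictFDerivAt_norm_sq (p - x)).comp p ((hasStrictFDerivAt_id p).sub_const x)
  obtain ⟨a, b, hab, h⟩ := hext.exists_multipliers_of_hasStrictFDerivAt_1d hf' hφ'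
  have hG : ∀ v, fderiv ℝ f p v = inner ℝ (gradient f p) v := fun v => by
    rw [gradient, InnerProductSpace.toDual_symm_apply]
  have h' : a • gradient f p + (2 * b) • (p - x) = 0 := by
    refine ext_inner_right ℝ fun v => ?_
    have := DFunLike.congr_fun h v
    simp only [_root_.add_apply, _root_.smul_apply, hG,
      innerSL_apply_apply, _root_.zero_apply, smul_eq_mul, nsmul_eq_mul] at this
    rw [inner_add_left, real_inner_smul_left, real_inner_smul_left, inner_zero_left]
    push_cast at this
    linarith
  have hb : b ≠ 0 := by
    rintro rfl
    simp [hg] at h'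
    exact hab (by simp [h'])
  refine ⟨a / (2 * b), ?_⟩
  have h2 : (2 * b) • (x - p) = a • gradient f p := by
    rw [← sub_eq_zero, ← neg_eq_zero, ← h']; module
  rw [div_eq_inv_mul, mul_smul, ← h2, smul_smul, inv_mul_cancel₀ (by positivity), one_smul]

lemma contDiffAt_gradient {f : E3 → ℝ} {p : E3} {n : ℕ} (hf : ContDiffAt ℝ (n + 1 : ℕ) f p) :
    ContDiffAt ℝ n (gradient f) p := by
  have h1 : ContDiffAt ℝ n (fderiv ℝ f) p := hf.fderiv_right (by exact_mod_cast le_rfl)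
  exact (InnerProductSpace.toDual ℝ E3).symm.contDiff.contDiffAt.comp p h1

/-- The map `(y, t) ↦ (y + t ∇f(y), f(y))` has a left inverse near `(p, 0)`, by the inverse function
theorem. A point `x = y + t ∇f(y)` with foot point `y` on the zero set of `f` corresponds
to `(x, 0)`. -/
lemma exists_local_inverse_normal {f : E3 → ℝ} {p : E3} {n : ℕ} (hn : n ≠ 0)
    (hf : ContDiffAt ℝ (n + 1 : ℕ) f p) (hfp : f p = 0) (hg : gradient f p ≠ 0) :
    ∃ ψ : E3 × ℝ → E3 × ℝ, ContDiffAt ℝ n ψ (p, 0) ∧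
      ∀ᶠ q in 𝓝 (p, (0 : ℝ)), ψ (q.1 + q.2 • gradient f q.1, f q.1) = q := by
  let Ψ : E3 × ℝ → E3 × ℝ := fun q => (q.1 + q.2 • gradient f q.1, f q.1)
  have hG : ContDiffAt ℝ n (gradient f) p := contDiffAt_gradient hf
  have hf1 : ContDiffAt ℝ n f p := hf.of_le (by exact_mod_cast n.le_succ)
  have hfst : ContDiffAt ℝ n (Prod.fst : E3 × ℝ → E3) (p, 0) := contDiffAt_fst
  have hG2 : ContDiffAt ℝ n (fun q : E3 × ℝ => gradient f q.1) (p, 0) :=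
    ContDiffAt.comp (p, (0 : ℝ)) (g := gradient f) hG hfst
  have hf2 : ContDiffAt ℝ n (fun q : E3 × ℝ => f q.1) (p, 0) :=
    ContDiffAt.comp (p, (0 : ℝ)) (g := f) hf1 hfst
  have hΨ : ContDiffAt ℝ n Ψ (p, 0) :=
    (hfst.add (contDiffAt_snd.smul hG2)).prodMk hf2
  have hn' : (n : WithTop ℕ∞) ≠ 0 := by exact_mod_cast hn
  have hG3 : HasFDerivAt (gradient f) (fderiv ℝ (gradient f) p) p :=
    (hG.differentiableAt hn').hasFDerivAt
  have hf3 : HasFDerivAt f (fderiv ℝ f p) p := (hf1.differentiableAt hn').hasFDerivAt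
  let A : E3 × ℝ →L[ℝ] E3 × ℝ :=
    (ContinuousLinearMap.fst ℝ E3 ℝ +
      (ContinuousLinearMap.snd ℝ E3 ℝ).smulRight (gradient f p)).prod
      ((fderiv ℝ f p).comp (ContinuousLinearMap.fst ℝ E3 ℝ))
  have hA : HasFDerivAt Ψ A (p, 0) := by
    have e1 : HasFDerivAt (fun q : E3 × ℝ => gradient f q.1)
        ((fderiv ℝ (gradient f) p).comp (ContinuousLinearMap.fst ℝ E3 ℝ)) (p, (0 : ℝ)) :=
      HasFDerivAt.comp (p, (0 : ℝ)) (g := gradient f) hG3 hasFDerivAt_fst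
    have e2 : HasFDerivAt (fun q : E3 × ℝ => f q.1)
        ((fderiv ℝ f p).comp (ContinuousLinearMap.fst ℝ E3 ℝ)) (p, (0 : ℝ)) :=
      HasFDerivAt.comp (p, (0 : ℝ)) (g := f) hf3 hasFDerivAt_fst
    have e3 := (hasFDerivAt_fst (𝕜 := ℝ) (p := (p, (0 : ℝ)))).add
      ((hasFDerivAt_snd (𝕜 := ℝ) (p := (p, (0 : ℝ)))).smul e1)
    refine (e3.prodMk e2).congr_fderiv ?_
    ext <;> simp [A]
  have hinner : ∀ v, fderiv ℝ f p v = inner ℝ (gradient f p) v := fun v => by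
    rw [gradient, InnerProductSpace.toDual_symm_apply]
  have hinj : Function.Injective A := by
    rw [injective_iff_map_eq_zero]
    rintro ⟨w, s⟩ h
    have h1 : w + s • gradient f p = 0 := congrArg Prod.fst h
    have h2 : inner ℝ (gradient f p) w = 0 := by rw [← hinner]; exact congrArg Prod.snd h
    have h3 : s * ‖gradient f p‖ ^ 2 = 0 := by
      have := congrArg (inner ℝ (gradient f p)) h1
      rw [inner_add_right, h2, real_inner_smul_right, real_inner_self_eq_norm_sq,
        inner_zero_right, zero_add] at this
      exact this
    have hs : s = 0 := by
      rcases mul_eq_zero.1 h3 with h | h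
      · exact h
      · exact absurd (by simpa using h) hg
    subst hs
    simpa using h1
  let A' : (E3 × ℝ) ≃L[ℝ] (E3 × ℝ) :=
    (LinearEquiv.ofInjectiveEndo (A : E3 × ℝ →ₗ[ℝ] E3 × ℝ) hinj).toContinuousLinearEquiv
  have hA' : HasFDerivAt Ψ (A' : E3 × ℝ →L[ℝ] E3 × ℝ) (p, 0) := by
    convert! hA using 1
  refine ⟨hΨ.localInverse hA' hn', ?_, ?_⟩
  · have := hΨ.to_localInverse hA' hn'
    have e : Ψ (p, 0) = (p, 0) := by simp [Ψ, hfp]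
    rwa [e] at this
  · exact (hΨ.hasStrictFDerivAt' hA' hn').eventually_left_inverse

lemma tangentialProjection_apply (n w : E3) :
    tangentialProjection n w = w - inner ℝ n w • n := by
  simp [tangentialProjection]

/-- Near `p ∈ Γ` the foot point of `x` and the multiplier of the gradient depend smoothly on `x`:
they are the components of `ψ (x, 0)`, with `ψ` the inverse of `(y, t) ↦ (y + t ∇f(y), f(y))`. This
holds for whichever nearest point `closestPoint` selects, so uniqueness needs no separate proof. -/
lemma exists_closestPoint_eq {Γ V : Set E3} (hc : IsCompact Γ) {p : E3} (hp : p ∈ Γ)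
    {f : E3 → ℝ} (hV : IsOpen V) (hpV : p ∈ V)
    (hf : ContDiffOn ℝ ((⊤ : ℕ∞) : WithTop ℕ∞) f V) (hΓV : Γ ∩ V = {x | x ∈ V ∧ f x = 0})
    (hg : ∀ x ∈ Γ ∩ V, gradient f x ≠ 0) {n : ℕ} (hn : n ≠ 0) :
    ∃ (q : E3 → E3) (t : E3 → ℝ), ContDiffAt ℝ n q p ∧ ContDiffAt ℝ n t p ∧
      ∀ᶠ x in 𝓝 p, closestPoint Γ x ∈ V ∧ closestPoint Γ x = q x ∧
        x - closestPoint Γ x = t x • gradient f (closestPoint Γ x) := by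
  have hfV : ∀ (m : ℕ), ∀ y ∈ V, ContDiffAt ℝ m f y := fun m y hy =>
    (hf.contDiffAt (hV.mem_nhds hy)).of_le (by exact_mod_cast le_top)
  have hfp : f p = 0 := by
    have : p ∈ Γ ∩ V := ⟨hp, hpV⟩
    rw [hΓV] at this; exact this.2
  have hgp := hg p ⟨hp, hpV⟩
  obtain ⟨ψ, hψ, hinv⟩ := exists_local_inverse_normal hn (hfV (n + 1) p hpV) hfp hgp
  have hpair : ContDiffAt ℝ n (fun x : E3 => (x, (0 : ℝ))) p :=
    contDiffAt_id.prodMk contDiffAt_const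
  have hψ2 : ContDiffAt ℝ n (fun x : E3 => ψ (x, 0)) p :=
    ContDiffAt.comp p (g := ψ) hψ hpair
  have hcp := tendsto_closestPoint hc hp
  have hG : Tendsto (fun x => gradient f (closestPoint Γ x)) (𝓝 p) (𝓝 (gradient f p)) :=
    ((contDiffAt_gradient (hfV (0 + 1) p hpV)).continuousAt.tendsto).comp hcp
  -- the multiplier of `x`, in a form that visibly tends to `0` as `x` tends to `p`
  let τ : E3 → ℝ := fun x => inner ℝ (gradient f (closestPoint Γ x)) (x - closestPoint Γ x) /
    ‖gradient f (closestPoint Γ x)‖ ^ 2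
  have hτ : Tendsto τ (𝓝 p) (𝓝 0) := by
    have h1 : Tendsto (fun x => x - closestPoint Γ x) (𝓝 p) (𝓝 (p - p)) := tendsto_id.sub hcp
    have h2 := (hG.inner h1).div (hG.norm.pow 2) (by positivity)
    rw [sub_self, inner_zero_right, zero_div] at h2
    exact h2
  refine ⟨fun x => (ψ (x, 0)).1, fun x => (ψ (x, 0)).2, hψ2.fst, hψ2.snd, ?_⟩
  filter_upwards [hcp (hV.mem_nhds hpV), (hcp.prodMk_nhds hτ).eventually hinv] with x hxV hx
  have hnear := isNearestPoint_closestPoint hc ⟨p, hp⟩ x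
  have hxΓ : closestPoint Γ x ∈ Γ ∩ V := ⟨hnear.1, hxV⟩
  obtain ⟨c, hcx⟩ := exists_smul_gradient_of_isNearestPoint hV hΓV hnear hxV (hfV 1 _ hxV)
    (hg _ hxΓ)
  have hcτ : τ x = c := by
    have : ‖gradient f (closestPoint Γ x)‖ ≠ 0 := norm_ne_zero_iff.2 (hg _ hxΓ)
    simp only [τ]
    rw [hcx, real_inner_smul_right, real_inner_self_eq_norm_sq]
    field_simp
  have hfx : f (closestPoint Γ x) = 0 := by rw [hΓV] at hxΓ; exact hxΓ.2
  have e : closestPoint Γ x + τ x • gradient f (closestPoint Γ x) = x := by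
    rw [hcτ, ← hcx]; abel
  simp only [hfx, e] at hx
  refine ⟨hxV, by rw [hx], ?_⟩
  simp only [hx, hcτ, hcx]

/-- The properties of the closest point projection, of the extended normal and of the signed
distance at a point `x` of the tube: they are of class `C^n`, and the differential of the
projection is tangential. -/
structure IsRegularPoint (Γ : Set E3) (ν : E3 → E3) (n : ℕ) (x : E3) : Prop where
  contDiffAt_closestPoint : ContDiffAt ℝ n (closestPoint Γ) x
  contDiffAt_normal : ContDiffAt ℝ n (surfaceNormal Γ ν) x
  contDiffAt_signedDistance : ContDiffAt ℝ n (signedDistance Γ ν) x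
  norm_normal : ‖surfaceNormal Γ ν x‖ = 1
  inner_normal_fderiv : ∀ v, inner ℝ (surfaceNormal Γ ν x) (fderiv ℝ (closestPoint Γ) x v) = 0

/-- Points near the surface are regular. On the surface, differentiating `x - π x = t(x) ∇f(π x)`
identifies the differential of the projection `π` as the tangential projection. -/
lemma eventually_isRegularPoint {Γ : Set E3} {ν : E3 → E3} (hc : IsCompact Γ)
    (hΓ : IsOrientedSmoothSurface Γ ν) {p : E3} (hp : p ∈ Γ) {n : ℕ} (hn : n ≠ 0) :
    (∀ᶠ x in 𝓝 p, IsRegularPoint Γ ν n x) ∧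
      fderiv ℝ (closestPoint Γ) p = tangentialProjection (surfaceNormal Γ ν p) := by
  obtain ⟨V, f, hV, hpV, hf, hΓV, hfν⟩ := hΓ.exists_local_equation p hp
  obtain ⟨q, t, hq, ht, hev⟩ := exists_closestPoint_eq hc hp hV hpV hf hΓV
    (fun x hx => (hfν x hx).1) hn
  have hn' : (n : WithTop ℕ∞) ≠ 0 := by exact_mod_cast hn
  have hninf : (n : WithTop ℕ∞) ≠ ((⊤ : ℕ∞) : WithTop ℕ∞) := by
    exact_mod_cast (ENat.natCast_ne_top n)
  have hfV : ∀ (m : ℕ), ∀ y ∈ V, ContDiffAt ℝ m f y := fun m y hy =>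
    (hf.contDiffAt (hV.mem_nhds hy)).of_le (by exact_mod_cast le_top)
  have hpp := closestPoint_of_mem hc hp
  have hmem : ∀ x, closestPoint Γ x ∈ Γ := fun x =>
    (isNearestPoint_closestPoint hc ⟨p, hp⟩ x).1
  have hπ : ContDiffAt ℝ n (closestPoint Γ) p :=
    hq.congr_of_eventuallyEq (hev.mono fun x hx => hx.2.1)
  have hGπ : ContDiffAt ℝ n (fun x => gradient f (closestPoint Γ x)) p := by
    refine ContDiffAt.comp p (g := gradient f) ?_ hπ
    rw [hpp]; exact contDiffAt_gradient (hfV _ p hpV)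
  have hgp : gradient f (closestPoint Γ p) ≠ 0 := by rw [hpp]; exact (hfν p ⟨hp, hpV⟩).1
  have hνG : ∀ᶠ x in 𝓝 p, surfaceNormal Γ ν x =
      ‖gradient f (closestPoint Γ x)‖⁻¹ • gradient f (closestPoint Γ x) :=
    hev.mono fun x hx => (hfν _ ⟨hmem x, hx.1⟩).2
  have hν : ContDiffAt ℝ n (surfaceNormal Γ ν) p :=
    (((hGπ.norm ℝ hgp).inv (norm_ne_zero_iff.2 hgp)).smul hGπ).congr_of_eventuallyEq hνG
  have hnorm : ∀ᶠ x in 𝓝 p, ‖surfaceNormal Γ ν x‖ = 1 := by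
    filter_upwards [hνG, hev] with x hx hx2
    rw [hx, norm_smul, norm_inv, norm_norm,
      inv_mul_cancel₀ (norm_ne_zero_iff.2 (hfν _ ⟨hmem x, hx2.1⟩).1)]
  -- near `p` the signed distance is the inner product of `x - π x` with the normal
  have hd : ContDiffAt ℝ n (signedDistance Γ ν) p := by
    refine ((contDiffAt_id.sub hπ).inner ℝ hν).congr_of_eventuallyEq ?_
    filter_upwards [hνG, hev, hnorm] with x hx hx2 hx3
    have h1 : x - closestPoint Γ x =
        (t x * ‖gradient f (closestPoint Γ x)‖) • surfaceNormal Γ ν x := by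
      rw [hx, smul_smul, mul_assoc,
        mul_inv_cancel₀ (norm_ne_zero_iff.2 (hfν _ ⟨hmem x, hx2.1⟩).1), mul_one, hx2.2.2]
    set s := t x * ‖gradient f (closestPoint Γ x)‖
    have h2 : inner ℝ (x - closestPoint Γ x) (surfaceNormal Γ ν x) = s := by
      rw [h1, real_inner_smul_left, real_inner_self_eq_norm_sq, hx3]; ring
    have h3 : Metric.infDist x Γ = |s| := by
      rw [← (isNearestPoint_closestPoint hc ⟨p, hp⟩ x).2, dist_eq_norm, h1, norm_smul, hx3,
        mul_one, Real.norm_eq_abs]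
    have h4 : signedDistance Γ ν x = s := by
      unfold signedDistance
      change (if 0 ≤ inner ℝ (x - closestPoint Γ x) (surfaceNormal Γ ν x) then _ else _) = _
      rw [h2, h3]
      split_ifs with h
      · exact abs_of_nonneg h
      · rw [abs_of_neg (not_le.1 h), neg_neg]
    simp only [id]
    exact h4.trans h2.symm
  have htan : ∀ᶠ x in 𝓝 p, ∀ v,
      inner ℝ (surfaceNormal Γ ν x) (fderiv ℝ (closestPoint Γ) x v) = 0 := by
    filter_upwards [hνG, hev, hev.eventually_nhds, hπ.eventually hninf] with x hx hx2 hx3 hx4 v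
    have h0 : (fun y => f (closestPoint Γ y)) =ᶠ[𝓝 x] fun _ => 0 := by
      filter_upwards [hx3] with y hy
      have : closestPoint Γ y ∈ Γ ∩ V := ⟨hmem y, hy.1⟩
      rw [hΓV] at this; exact this.2
    have h1 : HasFDerivAt (fun y => f (closestPoint Γ y))
        ((fderiv ℝ f (closestPoint Γ x)).comp (fderiv ℝ (closestPoint Γ) x)) x :=
      HasFDerivAt.comp x (g := f)
        ((hfV 1 _ hx2.1).differentiableAt (by simp)).hasFDerivAt
        (hx4.differentiableAt hn').hasFDerivAt
    have h2 := h1.unique ((hasFDerivAt_const (0 : ℝ) x).congr_of_eventuallyEq h0)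
    have h3 : inner ℝ (gradient f (closestPoint Γ x)) (fderiv ℝ (closestPoint Γ) x v) = 0 := by
      rw [gradient, InnerProductSpace.toDual_symm_apply]
      exact DFunLike.congr_fun h2 v
    rw [hx, real_inner_smul_left, h3, mul_zero]
  refine ⟨?_, ?_⟩
  · filter_upwards [hπ.eventually hninf, hν.eventually hninf, hd.eventually hninf, hnorm, htan]
      with x h1 h2 h3 h4 h5
    exact ⟨h1, h2, h3, h4, h5⟩
  · have hev0 := hev.self_of_nhds
    have ht0 : t p = 0 := by
      have h := hev0.2.2
      rw [hpp, sub_self] at h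
      rcases smul_eq_zero.1 h.symm with h | h
      · exact h
      · exact absurd h (hpp ▸ hgp)
    have h1 : HasFDerivAt (fun x => x - closestPoint Γ x)
        (ContinuousLinearMap.id ℝ E3 - fderiv ℝ (closestPoint Γ) p) p :=
      (hasFDerivAt_id p).sub (hπ.differentiableAt hn').hasFDerivAt
    have h2 := ((ht.differentiableAt hn').hasFDerivAt).smul
      ((hGπ.differentiableAt hn').hasFDerivAt)
    have h3 := h1.unique (h2.congr_of_eventuallyEq (hev.mono fun x hx => hx.2.2))
    ext1 v
    have h4 : v - fderiv ℝ (closestPoint Γ) p v = fderiv ℝ t p v • gradient f p := by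
      have := DFunLike.congr_fun h3 v
      simpa [ht0, hpp] using this
    have hνp := hνG.self_of_nhds
    rw [hpp] at hνp
    have hgp' : ‖gradient f p‖ ≠ 0 := norm_ne_zero_iff.2 (hpp ▸ hgp)
    have h5 : gradient f p = ‖gradient f p‖ • surfaceNormal Γ ν p := by
      rw [hνp, smul_smul, mul_inv_cancel₀ hgp', one_smul]
    rw [h5, smul_smul] at h4
    have h6 : inner ℝ (surfaceNormal Γ ν p) v = fderiv ℝ t p v * ‖gradient f p‖ := by
      have := congrArg (inner ℝ (surfaceNormal Γ ν p)) h4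
      rw [inner_sub_right, htan.self_of_nhds v, real_inner_smul_right, real_inner_self_eq_norm_sq,
        hnorm.self_of_nhds] at this
      linarith
    rw [tangentialProjection_apply, h6, ← h4]
    abel

/-- Uniform bounds in the balls of radius `r` about points of the surface: `M` bounds the
derivatives of the closest point projection up to order `k + 1`, the Lipschitz constant of the
normal, the Hessian of the signed distance, and, relative to the distance from the surface, the
deviation of the differential of the projection from the tangential projection. -/
structure IsTube (Γ : Set E3) (ν : E3 → E3) (k : ℕ) (r M : ℝ) : Prop where
  isRegularPoint : ∀ p ∈ Γ, ∀ y ∈ Metric.ball p r, IsRegularPoint Γ ν (k + 2) y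
  norm_iteratedFDeriv_le : ∀ p ∈ Γ, ∀ y ∈ Metric.ball p r, ∀ m ≤ k + 1,
    ‖iteratedFDeriv ℝ m (closestPoint Γ) y‖ ≤ M
  norm_fderiv_sub_le : ∀ p ∈ Γ, ∀ y ∈ Metric.ball p r, ∀ z ∈ Metric.ball p r,
    ‖fderiv ℝ (closestPoint Γ) y - fderiv ℝ (closestPoint Γ) z‖ ≤ M * ‖y - z‖
  norm_fderiv_sub_tangentialProjection_le : ∀ p ∈ Γ, ∀ y ∈ Metric.ball p r,
    ‖fderiv ℝ (closestPoint Γ) y - tangentialProjection (surfaceNormal Γ ν y)‖ ≤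
      M * |signedDistance Γ ν y|
  norm_normal_sub_le : ∀ p ∈ Γ, ∀ y ∈ Metric.ball p r, ∀ z ∈ Metric.ball p r,
    ‖surfaceNormal Γ ν y - surfaceNormal Γ ν z‖ ≤ M * ‖y - z‖
  norm_distanceHessian_le : ∀ p ∈ Γ, ∀ y ∈ Metric.ball p r, ‖distanceHessian Γ ν y‖ ≤ M

lemma exists_isTube {Γ : Set E3} {ν : E3 → E3} (hc : IsCompact Γ)
    (hΓ : IsOrientedSmoothSurface Γ ν) {k : ℕ} (hk : 1 ≤ k) :
    ∃ r > 0, ∃ M ≥ 1, IsTube Γ ν k r M := by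
  let U : Set E3 := {x | IsRegularPoint Γ ν (k + 2) x}
  have hU : Γ ⊆ interior U := fun p hp =>
    mem_interior_iff_mem_nhds.2 (eventually_isRegularPoint hc hΓ hp (by omega)).1
  obtain ⟨r, hr, hrU⟩ := hc.exists_cthickening_subset_open isOpen_interior hU
  have hK : IsCompact (Metric.cthickening r Γ) := hc.cthickening
  have hreg : ∀ y ∈ Metric.cthickening r Γ, IsRegularPoint Γ ν (k + 2) y := fun y hy =>
    interior_subset (hrU hy)
  have hball : ∀ p ∈ Γ, Metric.ball p r ⊆ Metric.cthickening r Γ := fun p hp =>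
    (Metric.ball_subset_thickening hp r).trans (Metric.thickening_subset_cthickening r Γ)
  have bound : ∀ {F : Type} [NormedAddCommGroup F] (g : E3 → F),
      (∀ y ∈ Metric.cthickening r Γ, ContinuousAt g y) →
      ∃ B, ∀ y ∈ Metric.cthickening r Γ, ‖g y‖ ≤ B := fun g hg =>
    hK.exists_bound_of_continuousOn fun y hy => (hg y hy).continuousWithinAt
  have hder : ∀ m, m ≤ k + 1 → ∃ B, ∀ y ∈ Metric.cthickening r Γ,
      ‖iteratedFDeriv ℝ m (closestPoint Γ) y‖ ≤ B := fun m hm => bound _ fun y hy =>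
    ((hreg y hy).contDiffAt_closestPoint.differentiableAt_iteratedFDeriv
      (by exact_mod_cast (by omega : m < k + 2))).continuousAt
  choose! B hB using hder
  obtain ⟨B₂, hB₂⟩ := bound (fderiv ℝ (fderiv ℝ (closestPoint Γ))) fun y hy => by
    have h1 : ContDiffAt ℝ 1 (fderiv ℝ (closestPoint Γ)) y :=
      (hreg y hy).contDiffAt_closestPoint.fderiv_right
        (by exact_mod_cast (by omega : 1 + 1 ≤ k + 2))
    exact (h1.fderiv_right (m := 0) (by simp)).continuousAt
  obtain ⟨B₃, hB₃⟩ := bound (fderiv ℝ (surfaceNormal Γ ν)) fun y hy =>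
    ((hreg y hy).contDiffAt_normal.fderiv_right (m := 0)
        (by exact_mod_cast (by omega : 0 + 1 ≤ k + 2))).continuousAt
  obtain ⟨B₄, hB₄⟩ := bound (distanceHessian Γ ν) fun y hy => by
    have h1 : ContDiffAt ℝ 1 (gradient (signedDistance Γ ν)) y :=
      contDiffAt_gradient (n := 1) ((hreg y hy).contDiffAt_signedDistance.of_le
        (by exact_mod_cast (by omega : 1 + 1 ≤ k + 2)))
    exact (h1.fderiv_right (m := 0) (by simp)).continuousAt
  let M : ℝ := 1 + ∑ m ∈ Finset.range (k + 2), |B m| + |B₂| + |B₃| + |B₄|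
  have hsum : 0 ≤ ∑ m ∈ Finset.range (k + 2), |B m| := Finset.sum_nonneg fun _ _ => abs_nonneg _
  have hM1 : 1 ≤ M := by simp only [M]; linarith [abs_nonneg B₂, abs_nonneg B₃, abs_nonneg B₄]
  have hM2 : B₂ ≤ M := by
    simp only [M]; linarith [le_abs_self B₂, abs_nonneg B₃, abs_nonneg B₄]
  have hM3 : B₃ ≤ M := by
    simp only [M]; linarith [abs_nonneg B₂, le_abs_self B₃, abs_nonneg B₄]
  have hM4 : B₄ ≤ M := by
    simp only [M]; linarith [abs_nonneg B₂, abs_nonneg B₃, le_abs_self B₄]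
  have hMB : ∀ m ≤ k + 1, B m ≤ M := fun m hm => by
    have := Finset.single_le_sum (f := fun m => |B m|) (fun i _ => abs_nonneg _)
      (Finset.mem_range.2 (by omega : m < k + 2))
    simp only [M]
    linarith [le_abs_self (B m), abs_nonneg B₂, abs_nonneg B₃, abs_nonneg B₄]
  have hlip : ∀ p ∈ Γ, ∀ y ∈ Metric.ball p r, ∀ z ∈ Metric.ball p r,
      ‖fderiv ℝ (closestPoint Γ) y - fderiv ℝ (closestPoint Γ) z‖ ≤ M * ‖y - z‖ := by
    intro p hp y hy z hz
    refine (convex_ball p r).norm_image_sub_le_of_norm_fderiv_le (𝕜 := ℝ) (fun x hx => ?_)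
      (fun x hx => (hB₂ x (hball p hp hx)).trans hM2) hz hy
    have h1 : ContDiffAt ℝ 1 (fderiv ℝ (closestPoint Γ)) x :=
      (hreg x (hball p hp hx)).contDiffAt_closestPoint.fderiv_right
        (by exact_mod_cast (by omega : 1 + 1 ≤ k + 2))
    exact h1.differentiableAt one_ne_zero
  refine ⟨r, hr, M, hM1, ⟨fun p hp y hy => hreg y (hball p hp hy),
    fun p hp y hy m hm => (hB m hm y (hball p hp hy)).trans (hMB m hm), hlip, ?_, ?_,
    fun p hp y hy => (hB₄ y (hball p hp hy)).trans hM4⟩⟩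
  · intro p hp y hy
    have hnear := isNearestPoint_closestPoint hc ⟨p, hp⟩ y
    set q := closestPoint Γ y
    have hq : closestPoint Γ q = q := closestPoint_of_mem hc hnear.1
    have hyq : dist y q < r := by
      rw [hnear.2]
      exact (Metric.infDist_le_dist_of_mem hp).trans_lt hy
    have h1 := hlip q hnear.1 y hyq q (Metric.mem_ball_self hr)
    rw [(eventually_isRegularPoint hc hΓ hnear.1 (n := 1) one_ne_zero).2] at h1
    have h2 : surfaceNormal Γ ν q = surfaceNormal Γ ν y := by
      change ν (closestPoint Γ q) = ν q
      rw [hq]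
    rwa [h2, ← dist_eq_norm y q, hnear.2, ← abs_signedDistance Γ ν y] at h1
  · intro p hp y hy z hz
    refine (convex_ball p r).norm_image_sub_le_of_norm_fderiv_le (𝕜 := ℝ) (fun x hx => ?_)
      (fun x hx => (hB₃ x (hball p hp hx)).trans hM3) hz hy
    exact (hreg x (hball p hp hx)).contDiffAt_normal.differentiableAt
      (by exact_mod_cast (by omega : k + 2 ≠ 0))

/-! ### Linear algebra of almost tangential vectors -/

lemma abs_sub_one_le_abs_sq_sub_one {s : ℝ} (hs : 0 ≤ s) : |s - 1| ≤ |s ^ 2 - 1| := by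
  have h : s ^ 2 - 1 = (s - 1) * (s + 1) := by ring
  rw [h, abs_mul, abs_of_nonneg (by linarith : 0 ≤ s + 1)]
  nlinarith [abs_nonneg (s - 1)]

lemma parallelogramArea_nonneg (u v : E3) : 0 ≤ parallelogramArea u v := Real.sqrt_nonneg _

lemma parallelogramArea_sq (u v : E3) :
    parallelogramArea u v ^ 2 = ‖u‖ ^ 2 * ‖v‖ ^ 2 - inner ℝ u v ^ 2 := by
  refine Real.sq_sqrt ?_
  have := sq_le_sq' (by linarith [neg_le_of_abs_le (abs_real_inner_le_norm u v)])
    (real_inner_le_norm u v)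
  nlinarith

lemma parallelogramArea_le (u v : E3) : parallelogramArea u v ≤ ‖u‖ * ‖v‖ := by
  refine abs_le_of_sq_le_sq' ?_ (by positivity) |>.2
  rw [parallelogramArea_sq]
  nlinarith [sq_nonneg (inner ℝ u v)]

lemma parallelogramArea_comm (u v : E3) : parallelogramArea u v = parallelogramArea v u := by
  rw [parallelogramArea, parallelogramArea, real_inner_comm, mul_comm]

/-- Shearing along `v` preserves the area. -/
lemma parallelogramArea_smul_add (s t : ℝ) (u v : E3) :
    parallelogramArea (s • u + t • v) v = |s| * parallelogramArea u v := by
  refine (sq_eq_sq₀ (parallelogramArea_nonneg _ _)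
    (mul_nonneg (abs_nonneg _) (parallelogramArea_nonneg _ _))).1 ?_
  rw [mul_pow, parallelogramArea_sq, parallelogramArea_sq, sq_abs, norm_add_sq_real, norm_smul,
    norm_smul, inner_add_left, real_inner_smul_left, real_inner_smul_left, real_inner_smul_right,
    real_inner_smul_left, real_inner_self_eq_norm_sq, mul_pow, mul_pow, Real.norm_eq_abs,
    Real.norm_eq_abs, sq_abs, sq_abs]
  ring

lemma sq_le_parallelogramArea {u v : E3} {c : ℝ} (hc : 0 ≤ c)
    (h : ∀ s t : ℝ, c * max |s| |t| ≤ ‖s • u + t • v‖) : c ^ 2 ≤ parallelogramArea u v := by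
  have hv : c ≤ ‖v‖ := by simpa using h 0 1
  rcases hc.eq_or_lt with rfl | hc
  · simpa using parallelogramArea_nonneg u v
  have hv0 : 0 < ‖v‖ := hc.trans_le hv
  set b := inner ℝ u v / ‖v‖ ^ 2
  have hb : b * ‖v‖ ^ 2 = inner ℝ u v := div_mul_cancel₀ _ (by positivity)
  have hw : c ≤ ‖u - b • v‖ := by
    have h1 := h 1 (-b)
    rw [one_smul, neg_smul, ← sub_eq_add_neg] at h1
    refine le_trans ?_ h1
    exact le_mul_of_one_le_right hc.le (le_max_of_le_left (by simp))
  -- the height of the parallelogram is the norm of the component of `u` orthogonal to `v`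
  have h2 : (‖u - b • v‖ * ‖v‖) ^ 2 = parallelogramArea u v ^ 2 := by
    rw [parallelogramArea_sq, mul_pow, norm_sub_sq_real, real_inner_smul_right, norm_smul, mul_pow,
      Real.norm_eq_abs, sq_abs, ← hb]
    ring
  rw [← (sq_eq_sq₀ (by positivity) (parallelogramArea_nonneg _ _)).1 h2, sq]
  exact mul_le_mul hw hv hc.le (norm_nonneg _)

lemma norm_tangentialProjection_apply_sq {n : E3} (hn : ‖n‖ = 1) (w : E3) :
    ‖tangentialProjection n w‖ ^ 2 = ‖w‖ ^ 2 - inner ℝ n w ^ 2 := by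
  rw [tangentialProjection_apply, norm_sub_sq_real, real_inner_smul_right, norm_smul, hn,
    real_inner_comm, Real.norm_eq_abs, mul_one, sq_abs]
  ring

lemma norm_tangentialProjection_apply_le {n : E3} (hn : ‖n‖ = 1) (w : E3) :
    ‖tangentialProjection n w‖ ≤ ‖w‖ := by
  refine abs_le_of_sq_le_sq' ?_ (norm_nonneg _) |>.2
  rw [norm_tangentialProjection_apply_sq hn]
  nlinarith [sq_nonneg (inner ℝ n w)]

lemma inner_tangentialProjection {n : E3} (hn : ‖n‖ = 1) (v w : E3) :
    inner ℝ (tangentialProjection n v) (tangentialProjection n w) =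
      inner ℝ v w - inner ℝ n v * inner ℝ n w := by
  simp only [tangentialProjection_apply, inner_sub_left, inner_sub_right, real_inner_smul_left,
    real_inner_smul_right, real_inner_self_eq_norm_sq, hn, real_inner_comm n v]
  ring

/-- The linear map `Q`, in the application the differential of the closest point projection, is
within `η` of the projection onto the plane orthogonal to the unit vector `n`, and its range lies
in that plane. The bound on `η` keeps `Q` away from degenerating on that plane. -/
structure IsAlmostProjection (n : E3) (Q : E3 →L[ℝ] E3) (η : ℝ) : Prop where
  norm_normal : ‖n‖ = 1
  norm_sub_le : ‖Q - tangentialProjection n‖ ≤ η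
  le_eighth : η ≤ 1 / 8
  inner_eq_zero : ∀ v, inner ℝ n (Q v) = 0

namespace IsAlmostProjection
variable {n : E3} {Q : E3 →L[ℝ] E3} {η ε : ℝ} (hQ : IsAlmostProjection n Q η)
include hQ

lemma nonneg : 0 ≤ η := (norm_nonneg _).trans hQ.norm_sub_le

lemma norm_apply_sub_le (w : E3) : ‖Q w - tangentialProjection n w‖ ≤ η * ‖w‖ :=
  (Q - tangentialProjection n).le_of_opNorm_le hQ.norm_sub_le w

lemma norm_apply_le (w : E3) : ‖Q w‖ ≤ 2 * ‖w‖ := by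
  have h1 := hQ.norm_apply_sub_le w
  have h2 := norm_tangentialProjection_apply_le hQ.norm_normal w
  have h3 := norm_le_norm_add_norm_sub' (Q w) (tangentialProjection n w)
  nlinarith [hQ.le_eighth, norm_nonneg w]

/-- Inner products of vectors that are orthogonal to `n` up to `ε` change by `O(ε²)` under the
orthogonal projection. -/
lemma abs_inner_sub_le (hε : ε ^ 2 ≤ η) {v w : E3} (hv : |inner ℝ n v| ≤ ε * ‖v‖)
    (hw : |inner ℝ n w| ≤ ε * ‖w‖) :
    |inner ℝ (Q v) (Q w) - inner ℝ v w| ≤ 4 * η * (‖v‖ * ‖w‖) := by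
  set P := tangentialProjection n
  have e : inner ℝ (Q v) (Q w) - inner ℝ v w = inner ℝ (Q v - P v) (Q w) +
      inner ℝ (P v) (Q w - P w) - inner ℝ n v * inner ℝ n w := by
    have := inner_tangentialProjection hQ.norm_normal v w
    rw [inner_sub_left, inner_sub_right]
    change inner ℝ (P v) (P w) = _ at this
    linarith
  have h1 : |inner ℝ (Q v - P v) (Q w)| ≤ (η * ‖v‖) * (2 * ‖w‖) :=
    (abs_real_inner_le_norm _ _).trans (mul_le_mul (hQ.norm_apply_sub_le v) (hQ.norm_apply_le w)
      (norm_nonneg _) (mul_nonneg hQ.nonneg (norm_nonneg _)))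
  have h2 : |inner ℝ (P v) (Q w - P w)| ≤ ‖v‖ * (η * ‖w‖) :=
    (abs_real_inner_le_norm _ _).trans (mul_le_mul
      (norm_tangentialProjection_apply_le hQ.norm_normal v) (hQ.norm_apply_sub_le w)
      (norm_nonneg _) (norm_nonneg _))
  have h3 : |inner ℝ n v * inner ℝ n w| ≤ η * (‖v‖ * ‖w‖) := by
    rw [abs_mul]
    calc _ ≤ (ε * ‖v‖) * (ε * ‖w‖) := mul_le_mul hv hw (abs_nonneg _) ((abs_nonneg _).trans hv)
      _ = ε ^ 2 * (‖v‖ * ‖w‖) := by ring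
      _ ≤ _ := by gcongr
  rw [e]
  refine (abs_sub _ _).trans ?_
  linarith [abs_add_le (inner ℝ (Q v - P v) (Q w)) (inner ℝ (P v) (Q w - P w))]

lemma abs_norm_sq_sub_le (hε : ε ^ 2 ≤ η) {w : E3} (hw : |inner ℝ n w| ≤ ε * ‖w‖) :
    |‖Q w‖ ^ 2 - ‖w‖ ^ 2| ≤ 4 * η * ‖w‖ ^ 2 := by
  have := hQ.abs_inner_sub_le hε hw hw
  rwa [real_inner_self_eq_norm_sq, real_inner_self_eq_norm_sq, ← sq] at this

lemma abs_one_sub_norm_div_le (hε : ε ^ 2 ≤ η) {w : E3} (hw0 : w ≠ 0)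
    (hw : |inner ℝ n w| ≤ ε * ‖w‖) : |1 - ‖Q w‖ / ‖w‖| ≤ 4 * η := by
  have hpos : 0 < ‖w‖ := norm_pos_iff.2 hw0
  rw [abs_sub_comm]
  refine (abs_sub_one_le_abs_sq_sub_one (by positivity)).trans ?_
  have e : (‖Q w‖ / ‖w‖) ^ 2 - 1 = (‖Q w‖ ^ 2 - ‖w‖ ^ 2) / ‖w‖ ^ 2 := by field_simp
  rw [e, abs_div, abs_of_pos (by positivity : 0 < ‖w‖ ^ 2), div_le_iff₀ (by positivity)]
  exact hQ.abs_norm_sq_sub_le hε hw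

/-- The area changes by `O(η)` because the entries of the Gram matrix do. `K` measures how far the
parallelogram is from degenerate. -/
lemma abs_one_sub_area_div_le (hε : ε ^ 2 ≤ η) {u v : E3} {K : ℝ}
    (hu : |inner ℝ n u| ≤ ε * ‖u‖) (hv : |inner ℝ n v| ≤ ε * ‖v‖)
    (hpos : 0 < parallelogramArea u v) (hK : ‖u‖ * ‖v‖ ≤ K * parallelogramArea u v) :
    |1 - parallelogramArea (Q u) (Q v) / parallelogramArea u v| ≤ 48 * K ^ 2 * η := by
  have hη := hQ.nonneg
  have hη1 := hQ.le_eighth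
  set A := parallelogramArea u v
  have h1 := hQ.abs_norm_sq_sub_le hε hu
  have h2 := hQ.abs_norm_sq_sub_le hε hv
  have h3 := hQ.abs_inner_sub_le hε hu hv
  have hQv : ‖Q v‖ ^ 2 ≤ 4 * ‖v‖ ^ 2 := by
    have := pow_le_pow_left₀ (norm_nonneg _) (hQ.norm_apply_le v) 2
    nlinarith
  have h4 : |(‖Q u‖ ^ 2 - ‖u‖ ^ 2) * ‖Q v‖ ^ 2| ≤ (4 * η * ‖u‖ ^ 2) * (4 * ‖v‖ ^ 2) := by
    rw [abs_mul, abs_of_nonneg (sq_nonneg ‖Q v‖)]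
    exact mul_le_mul h1 hQv (by positivity) (by positivity)
  have h5 : |‖u‖ ^ 2 * (‖Q v‖ ^ 2 - ‖v‖ ^ 2)| ≤ ‖u‖ ^ 2 * (4 * η * ‖v‖ ^ 2) := by
    rw [abs_mul, abs_of_nonneg (sq_nonneg ‖u‖)]
    gcongr
  have h6 : |inner ℝ (Q u) (Q v) + inner ℝ u v| ≤ 5 * (‖u‖ * ‖v‖) := by
    have a1 : |inner ℝ (Q u) (Q v)| ≤ (2 * ‖u‖) * (2 * ‖v‖) :=
      (abs_real_inner_le_norm _ _).trans (mul_le_mul (hQ.norm_apply_le u) (hQ.norm_apply_le v)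
        (norm_nonneg _) (by positivity))
    have a2 := abs_real_inner_le_norm u v
    have a3 := abs_add_le (inner ℝ (Q u) (Q v)) (inner ℝ u v)
    nlinarith
  have h7 : |(inner ℝ (Q u) (Q v) - inner ℝ u v) * (inner ℝ (Q u) (Q v) + inner ℝ u v)| ≤
      (4 * η * (‖u‖ * ‖v‖)) * (5 * (‖u‖ * ‖v‖)) := by
    rw [abs_mul]
    exact mul_le_mul h3 h6 (abs_nonneg _) (by positivity)
  have hsq : (‖u‖ * ‖v‖) ^ 2 ≤ (K * A) ^ 2 := pow_le_pow_left₀ (by positivity) hK 2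
  rw [abs_sub_comm]
  refine (abs_sub_one_le_abs_sq_sub_one
    (div_nonneg (parallelogramArea_nonneg _ _) hpos.le)).trans ?_
  have e : (parallelogramArea (Q u) (Q v) / A) ^ 2 - 1 =
      (parallelogramArea (Q u) (Q v) ^ 2 - A ^ 2) / A ^ 2 := by field_simp
  rw [e, abs_div, abs_of_pos (by positivity : 0 < A ^ 2), div_le_iff₀ (by positivity),
    parallelogramArea_sq, parallelogramArea_sq]
  have e2 : ‖Q u‖ ^ 2 * ‖Q v‖ ^ 2 - inner ℝ (Q u) (Q v) ^ 2 -
      (‖u‖ ^ 2 * ‖v‖ ^ 2 - inner ℝ u v ^ 2) =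
      (‖Q u‖ ^ 2 - ‖u‖ ^ 2) * ‖Q v‖ ^ 2 + ‖u‖ ^ 2 * (‖Q v‖ ^ 2 - ‖v‖ ^ 2) -
        (inner ℝ (Q u) (Q v) - inner ℝ u v) * (inner ℝ (Q u) (Q v) + inner ℝ u v) := by ring
  rw [e2]
  have hsum := (abs_sub _ _).trans (add_le_add
    ((abs_add_le ((‖Q u‖ ^ 2 - ‖u‖ ^ 2) * ‖Q v‖ ^ 2) (‖u‖ ^ 2 * (‖Q v‖ ^ 2 - ‖v‖ ^ 2))).trans
      (add_le_add h4 h5)) h7)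
  refine hsum.trans ?_
  calc _ = 40 * η * (‖u‖ * ‖v‖) ^ 2 := by ring
    _ ≤ 40 * η * (K * A) ^ 2 := by gcongr
    _ ≤ 48 * η * (K * A) ^ 2 := by gcongr; norm_num
    _ = _ := by
      have : A ^ 2 = ‖u‖ ^ 2 * ‖v‖ ^ 2 - inner ℝ u v ^ 2 := parallelogramArea_sq u v
      rw [← this]; ring

end IsAlmostProjection

/-- If `n` is orthogonal up to `ε` to the plane orthogonal to `m`, then its component in that plane,
of squared norm `1 - ⟪n, m⟫ ^ 2`, has norm at most `ε`. -/
lemma one_sub_inner_sq_le {n m : E3} {ε : ℝ} (hn : ‖n‖ = 1) (hm : ‖m‖ = 1) (hε : 0 ≤ ε)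
    (h : ∀ w, inner ℝ m w = 0 → |inner ℝ n w| ≤ ε * ‖w‖) : 1 - inner ℝ n m ^ 2 ≤ ε ^ 2 := by
  set w := n - inner ℝ n m • m
  have h1 : inner ℝ m w = 0 := by
    simp only [w, inner_sub_right, real_inner_smul_right, real_inner_self_eq_norm_sq, hm,
      real_inner_comm m n]
    ring
  have h2 : inner ℝ n w = 1 - inner ℝ n m ^ 2 := by
    simp only [w, inner_sub_right, real_inner_smul_right, real_inner_self_eq_norm_sq, hn]
    ring
  have h3 : ‖w‖ ^ 2 = 1 - inner ℝ n m ^ 2 := by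
    rw [← real_inner_self_eq_norm_sq]
    nth_rw 1 [show w = n - inner ℝ n m • m from rfl]
    rw [inner_sub_left, real_inner_smul_left, h1, h2]; ring
  have h4 := h w h1
  rw [h2, ← h3, abs_of_nonneg (sq_nonneg _), sq] at h4
  have h5 : ‖w‖ ≤ ε := by
    by_contra hlt
    push Not at hlt
    nlinarith [norm_nonneg w]
  rw [← h3]
  exact pow_le_pow_left₀ (norm_nonneg _) h5 2

lemma norm_sub_le_of_one_sub_inner_sq_le {n m : E3} {ε : ℝ} (hn : ‖n‖ = 1) (hm : ‖m‖ = 1)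
    (hε : 0 ≤ ε) (h0 : 0 ≤ inner ℝ m n) (h : 1 - inner ℝ n m ^ 2 ≤ ε ^ 2) : ‖n - m‖ ≤ 2 * ε := by
  refine abs_le_of_sq_le_sq' ?_ (by positivity) |>.2
  rw [norm_sub_sq_real, hn, hm]
  rw [real_inner_comm] at h0
  have h1 : inner ℝ n m ≤ 1 := by simpa [hn, hm] using real_inner_le_norm n m
  nlinarith

/-- If `m` is a unit normal of the range of an injective `A`, every vector orthogonal to `m` is
tangent. -/
lemma mem_range_of_inner_eq_zero {A : (Fin 2 → ℝ) →L[ℝ] E3} (hA : Function.Injective A) {m w : E3}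
    (hm : ‖m‖ = 1) (hmA : ∀ v, inner ℝ m (A v) = 0) (hw : inner ℝ m w = 0) : ∃ v, A v = w := by
  have hm0 : m ≠ 0 := by rintro rfl; simp at hm
  let R := LinearMap.range (A : (Fin 2 → ℝ) →ₗ[ℝ] E3)
  have h1 : Module.finrank ℝ R = 2 := by
    have := LinearMap.finrank_range_of_inj (f := (A : (Fin 2 → ℝ) →ₗ[ℝ] E3)) hA
    simpa using this
  have h2 : Module.finrank ℝ (ℝ ∙ m)ᗮ = 2 := by
    have : Fact (Module.finrank ℝ E3 = 2 + 1) := ⟨by simp⟩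
    exact Submodule.finrank_orthogonal_span_singleton hm0
  have hle : R ≤ (ℝ ∙ m)ᗮ := by
    rintro _ ⟨v, rfl⟩
    exact Submodule.mem_orthogonal_singleton_iff_inner_right.2 (hmA v)
  have heq := Submodule.eq_of_le_of_finrank_eq hle (h1.trans h2.symm)
  have : w ∈ R := heq ▸ Submodule.mem_orthogonal_singleton_iff_inner_right.2 hw
  exact this

/-- The deformation tensor is `O(η)`-close to the tangential projection `P` of `n`. The angle between
the planes orthogonal to `n` and `m` enters quadratically, through `P m ⊗ P m`, as
`‖P m‖ ^ 2 = 1 - ⟪n, m⟫ ^ 2`. -/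
lemma norm_projection_sub_deformation_le {n m : E3} {D : E3 →L[ℝ] E3} {δ c η : ℝ}
    (hn : ‖n‖ = 1) (hm : ‖m‖ = 1) (hnm : 1 - inner ℝ n m ^ 2 ≤ η) (hD : ‖D‖ ≤ η) (hη : η ≤ 1)
    (hδ : |1 - δ| ≤ c * η) (hδ' : |1 - δ| ≤ 1 / 2) :
    ‖tangentialProjection n - δ⁻¹ • (tangentialProjection n ∘L (ContinuousLinearMap.id ℝ E3 - D) ∘L
      tangentialProjection m ∘L (ContinuousLinearMap.id ℝ E3 - D) ∘L tangentialProjection n)‖ ≤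
      2 * (c + 4) * η := by
  set P := tangentialProjection n
  set S := tangentialProjection m
  have hη0 : 0 ≤ η := (norm_nonneg _).trans hD
  have hδ2 : 1 / 2 ≤ δ := by linarith [(abs_le.1 hδ').2]
  have hδ0 : 0 < δ := by linarith
  have hinv : ‖δ⁻¹‖ ≤ 2 := by
    rw [norm_inv, Real.norm_of_nonneg hδ0.le]
    exact inv_le_of_inv_le₀ (by norm_num) (by linarith)
  have hP : ∀ w, ‖P w‖ ≤ ‖w‖ := norm_tangentialProjection_apply_le hn
  have hS : ∀ w, ‖S w‖ ≤ ‖w‖ := norm_tangentialProjection_apply_le hm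
  have hDw : ∀ w, ‖D w‖ ≤ η * ‖w‖ := fun w => D.le_of_opNorm_le hD w
  have hPm : ‖P m‖ ^ 2 ≤ η := by
    rw [norm_tangentialProjection_apply_sq hn, hm]; simpa using hnm
  refine ContinuousLinearMap.opNorm_le_bound _ (by
    have : 0 ≤ c * η := (abs_nonneg _).trans hδ
    nlinarith) fun w => ?_
  have hPP : P (P w) = P w := by
    simp only [P, tangentialProjection_apply, inner_sub_right, real_inner_smul_right,
      real_inner_self_eq_norm_sq, hn]
    simp
  have hsym : inner ℝ m (P w) = inner ℝ (P m) w := by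
    simp only [P, tangentialProjection_apply, inner_sub_right, inner_sub_left,
      real_inner_smul_right, real_inner_smul_left, real_inner_comm n m]
    ring
  -- the defect splits into `δ - 1`, the angle between the planes, and the terms with `D`
  have e : (P - δ⁻¹ • (P ∘L (ContinuousLinearMap.id ℝ E3 - D) ∘L
      S ∘L (ContinuousLinearMap.id ℝ E3 - D) ∘L P)) w =
      δ⁻¹ • ((δ - 1) • P w + inner ℝ (P m) w • P m +
        P (D (S (P w)) + S (D (P w)) - D (S (D (P w))))) := by
    have h1 : S (P w) = P w - inner ℝ (P m) w • m := by
      rw [← hsym]; exact tangentialProjection_apply m (P w)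
    have h2 : P w = δ⁻¹ • δ • P w := by rw [smul_smul, inv_mul_cancel₀ hδ0.ne', one_smul]
    have h3 : P (S (P w)) = P w - inner ℝ (P m) w • P m := by rw [h1, map_sub, hPP, map_smul]
    simp only [_root_.sub_apply, _root_.smul_apply, ContinuousLinearMap.comp_apply,
      ContinuousLinearMap.id_apply, map_sub, map_add, h3]
    nth_rw 1 [h2]
    module
  rw [e, norm_smul]
  have h1 : ‖(δ - 1) • P w‖ ≤ c * η * ‖w‖ := by
    rw [norm_smul, Real.norm_eq_abs, abs_sub_comm]
    exact mul_le_mul hδ (hP w) (norm_nonneg _) ((abs_nonneg _).trans hδ)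
  have h2 : ‖inner ℝ (P m) w • P m‖ ≤ η * ‖w‖ := by
    rw [norm_smul, Real.norm_eq_abs]
    have := abs_real_inner_le_norm (P m) w
    nlinarith [norm_nonneg (P m), norm_nonneg w]
  have hηw : η * (η * ‖w‖) ≤ η * ‖w‖ := mul_le_of_le_one_left (by positivity) hη
  have a1 : ‖D (S (P w))‖ ≤ η * ‖w‖ := (hDw _).trans (by gcongr; exact (hS _).trans (hP w))
  have a2 : ‖S (D (P w))‖ ≤ η * ‖w‖ := (hS _).trans ((hDw _).trans (by gcongr; exact hP w))
  have a3 : ‖D (S (D (P w)))‖ ≤ η * ‖w‖ := (hDw _).trans (le_trans (by gcongr) hηw)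
  have h3 : ‖P (D (S (P w)) + S (D (P w)) - D (S (D (P w))))‖ ≤ 3 * η * ‖w‖ := by
    refine (hP _).trans ((norm_sub_le _ _).trans ?_)
    linarith [norm_add_le (D (S (P w))) (S (D (P w)))]
  have h4 := (norm_add₃_le (a := (δ - 1) • P w) (b := inner ℝ (P m) w • P m)
    (c := P (D (S (P w)) + S (D (P w)) - D (S (D (P w))))))
  calc _ ≤ 2 * (c * η * ‖w‖ + η * ‖w‖ + 3 * η * ‖w‖) :=
        mul_le_mul hinv (by linarith) (norm_nonneg _) zero_le_two
    _ = _ := by ring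

lemma eq_of_orthonormal_frame {n m τ q : E3} (hn : ‖n‖ = 1) (hm : ‖m‖ = 1) (hτ : ‖τ‖ = 1)
    (hnm : inner ℝ n m = 0) (hnτ : inner ℝ n τ = 0) (hmτ : inner ℝ m τ = 0)
    (hnq : inner ℝ n q = 0) : q = inner ℝ q m • m + inner ℝ q τ • τ := by
  have ho : Orthonormal ℝ ![n, m, τ] := by
    rw [orthonormal_iff_ite]
    intro i j
    fin_cases i <;> fin_cases j <;>
      simp [hn, hm, hτ, hnm, hnτ, hmτ, real_inner_comm n m, real_inner_comm n τ,
        real_inner_comm m τ]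
  have hspan := ho.linearIndependent.span_eq_top_of_card_eq_finrank (by simp)
  let b := OrthonormalBasis.mk ho hspan.ge
  have h := b.sum_repr' q
  rw [Fin.sum_univ_three] at h
  simp only [b, OrthonormalBasis.coe_mk, Matrix.cons_val, hnq, zero_smul, zero_add] at h
  rw [real_inner_comm m q, real_inner_comm τ q]
  exact h.symm

lemma baryDir_edgeDir (i : Fin 3) : baryDir (edgeDir i) i = 0 := by
  fin_cases i <;> simp [baryDir, edgeDir, refVertex]

lemma edgeDir_ne_zero (i : Fin 3) : edgeDir i ≠ 0 := by
  intro h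
  have h0 := congrFun h 0
  have h1 := congrFun h 1
  fin_cases i <;> simp [edgeDir, refVertex] at h0 h1

lemma baryDir_neg (v : Fin 2 → ℝ) (i : Fin 3) : baryDir (-v) i = -baryDir v i := by
  fin_cases i <;> simp [baryDir]; ring

lemma IsOuterConormal.inner_edgeDir {A : (Fin 2 → ℝ) →L[ℝ] E3} {i : Fin 3} {m : E3}
    (h : IsOuterConormal A i m) : inner ℝ m (A (edgeDir i)) = 0 := by
  refine le_antisymm (h.2.2 _ (baryDir_edgeDir i).ge) ?_
  have := h.2.2 (-edgeDir i) (by rw [baryDir_neg, baryDir_edgeDir, neg_zero])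
  rw [map_neg, inner_neg_right] at this
  linarith

/-- The image under `Q` of the conormal `mh` of `A` is almost of norm one and almost orthogonal to
the image of the edge; expanding it in the orthonormal frame given by `n`, the conormal `m` of
`Q ∘ A` and the edge tangent shows that it is close to `m` or `-m`, and the outward orientation
decides the sign. -/
lemma IsAlmostProjection.norm_conormal_sub_le {n m mh : E3} {Q : E3 →L[ℝ] E3} {η ε : ℝ}
    (hQ : IsAlmostProjection n Q η) (hε : ε ^ 2 ≤ η) {A : (Fin 2 → ℝ) →L[ℝ] E3}
    (hA : Function.Injective A) (hnA : ∀ v, |inner ℝ n (A v)| ≤ ε * ‖A v‖) {i : Fin 3}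
    (hm : IsOuterConormal (Q ∘L A) i m) (hmh : IsOuterConormal A i mh) :
    ‖m - tangentialProjection n mh‖ ≤ 21 * η := by
  have hη0 := hQ.nonneg
  have hη1 := hQ.le_eighth
  obtain ⟨w, rfl⟩ := hmh.2.1
  set q := Q (A w)
  set t := A (edgeDir i)
  have ht : 0 < ‖t‖ := norm_pos_iff.2 fun h =>
    edgeDir_ne_zero i (hA (h.trans (map_zero A).symm))
  have hnm : inner ℝ n m = 0 := by
    obtain ⟨v, rfl⟩ := hm.2.1
    exact hQ.inner_eq_zero _
  have hmt : inner ℝ m (Q t) = 0 := hm.inner_edgeDir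
  have hα0 : 0 ≤ inner ℝ q m := by
    have hneg : baryDir w i < 0 := by
      by_contra h
      have := hmh.2.2 w (not_lt.1 h)
      rw [real_inner_self_eq_norm_sq, hmh.1] at this
      norm_num at this
    have := hm.2.2 (-w) (by rw [baryDir_neg]; linarith)
    rw [map_neg, inner_neg_right] at this
    rw [real_inner_comm]
    exact neg_nonpos.1 this
  have hq1 : |‖q‖ ^ 2 - 1| ≤ 4 * η := by
    have := hQ.abs_norm_sq_sub_le hε (hnA w)
    rwa [hmh.1, one_pow, mul_one] at this
  have hqt : |inner ℝ q (Q t)| ≤ 4 * η * ‖t‖ := by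
    have := hQ.abs_inner_sub_le hε (hnA w) (hnA (edgeDir i))
    rwa [hmh.inner_edgeDir, hmh.1, one_mul, sub_zero] at this
  have hQt : ‖t‖ / 2 ≤ ‖Q t‖ := by
    have h1 := (abs_le.1 (hQ.abs_norm_sq_sub_le hε (hnA (edgeDir i)))).1
    refine abs_le_of_sq_le_sq' ?_ (norm_nonneg _) |>.2
    nlinarith [sq_nonneg ‖t‖]
  have hQt0 : 0 < ‖Q t‖ := by linarith
  set τ := ‖Q t‖⁻¹ • Q t
  have hτ : ‖τ‖ = 1 := by
    rw [norm_smul, norm_inv, norm_norm, inv_mul_cancel₀ hQt0.ne']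
  have hframe := eq_of_orthonormal_frame hQ.norm_normal hm.1 hτ hnm
    (by rw [real_inner_smul_right, hQ.inner_eq_zero, mul_zero])
    (by rw [real_inner_smul_right, hmt, mul_zero]) (hQ.inner_eq_zero (A w))
  set α := inner ℝ q m
  set β := inner ℝ q τ
  have hβ : |β| ≤ 8 * η := by
    have h1 : |β| * ‖Q t‖ = |inner ℝ q (Q t)| := by
      simp only [β, τ]
      rw [real_inner_smul_right, abs_mul, abs_inv, abs_norm]
      field_simp
    have h2 : |β| * ‖Q t‖ ≤ 8 * η * ‖Q t‖ := by rw [h1]; nlinarith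
    exact le_of_mul_le_mul_right h2 hQt0
  have hq2 : ‖q‖ ^ 2 = α ^ 2 + β ^ 2 := by
    change q = α • m + β • τ at hframe
    rw [hframe, norm_add_sq_real, norm_smul, norm_smul, hm.1, hτ, real_inner_smul_left,
      real_inner_smul_right, real_inner_smul_right, hmt]
    simp
  have hβ2 : β ^ 2 ≤ 8 * η := by
    rw [← sq_abs]
    nlinarith [abs_nonneg β]
  have hα : |α - 1| ≤ 12 * η := by
    refine (abs_sub_one_le_abs_sq_sub_one hα0).trans ?_
    rw [hq2] at hq1
    rw [abs_le] at hq1 ⊢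
    constructor <;> linarith [sq_nonneg β]
  have hmq : ‖m - q‖ ≤ 20 * η := by
    have e : m - q = -((α - 1) • m + β • τ) := by
      change q = α • m + β • τ at hframe
      rw [hframe]; module
    rw [e, norm_neg]
    refine (norm_add_le _ _).trans ?_
    rw [norm_smul, norm_smul, hm.1, hτ, Real.norm_eq_abs, Real.norm_eq_abs]
    linarith
  have hqP := hQ.norm_apply_sub_le (A w)
  rw [hmh.1, mul_one] at hqP
  linarith [norm_sub_le_norm_sub_add_norm_sub m q (tangentialProjection n (A w))]

/-! ### Geometry of the flat elements -/

lemma flatMap_mem_convexHull (a : Fin 3 → E3) {z : Fin 2 → ℝ} (hz : z ∈ refTriangle) :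
    flatMap a z ∈ convexHull ℝ (Set.range a) :=
  (convex_convexHull ℝ _).sum_mem (fun i _ => hz i)
    (by simp [Fin.sum_univ_three, bary]; ring) fun i _ => subset_convexHull ℝ _ ⟨i, rfl⟩

lemma isBounded_convexHull_range (a : Fin 3 → E3) :
    Bornology.IsBounded (convexHull ℝ (Set.range a)) :=
  isBounded_convexHull.2 (Set.finite_range a).isBounded

lemma dist_le_triDiam (a : Fin 3 → E3) {y z : E3} (hy : y ∈ convexHull ℝ (Set.range a))
    (hz : z ∈ convexHull ℝ (Set.range a)) : dist y z ≤ triDiam a :=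
  Metric.dist_le_diam_of_mem (isBounded_convexHull_range a) hy hz

lemma vertex_mem_convexHull (a : Fin 3 → E3) (i : Fin 3) : a i ∈ convexHull ℝ (Set.range a) :=
  subset_convexHull ℝ _ ⟨i, rfl⟩

lemma norm_vertex_sub_le (a : Fin 3 → E3) (i j : Fin 3) : ‖a i - a j‖ ≤ triDiam a := by
  rw [← dist_eq_norm]
  exact dist_le_triDiam a (vertex_mem_convexHull a i) (vertex_mem_convexHull a j)

lemma triDiam_le_perimeter (a : Fin 3 → E3) :
    triDiam a ≤ dist (a 0) (a 1) + dist (a 1) (a 2) + dist (a 2) (a 0) := by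
  rw [triDiam, convexHull_diam]
  refine Metric.diam_le_of_forall_dist_le (by positivity) ?_
  have h1 := @dist_nonneg _ _ (a 0) (a 1)
  have h2 := @dist_nonneg _ _ (a 1) (a 2)
  have h3 := @dist_nonneg _ _ (a 2) (a 0)
  rintro _ ⟨i, rfl⟩ _ ⟨j, rfl⟩
  fin_cases i <;> fin_cases j <;> simp [dist_comm (a 1) (a 0), dist_comm (a 2) (a 1),
    dist_comm (a 0) (a 2)] <;> linarith

/-- Shape regularity bounds the affine parametrization from below. -/
lemma triDiam_mul_norm_le {a : Fin 3 → E3} {σ : ℝ} (hσ : 0 < σ) (hpos : 0 < triDiam a)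
    (hreg : triDiam a ≤ σ * inscribedDiam a) (v : Fin 2 → ℝ) :
    triDiam a * ‖v‖ ≤ 2 * σ * ‖flatDeriv a v‖ := by
  set h := triDiam a
  set A := parallelogramArea (a 1 - a 0) (a 2 - a 0)
  have hper := triDiam_le_perimeter a
  have hA : h ^ 2 ≤ 2 * σ * A := by
    unfold inscribedDiam at hreg
    set ℓ := dist (a 0) (a 1) + dist (a 1) (a 2) + dist (a 2) (a 0)
    have hℓ : 0 < ℓ := hpos.trans_le hper
    have h1 : h * ℓ ≤ 2 * σ * A := by
      have : σ * (4 * (A / 2) / ℓ) = 2 * σ * A / ℓ := by ring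
      rw [this, le_div_iff₀ hℓ] at hreg
      exact hreg
    nlinarith
  have hcoord : ∀ s : ℝ, |s| * A ≤ ‖flatDeriv a v‖ * h → h * |s| ≤ 2 * σ * ‖flatDeriv a v‖ := by
    intro s hs
    have h1 : |s| * h ^ 2 ≤ 2 * σ * (‖flatDeriv a v‖ * h) := by
      have := mul_le_mul_of_nonneg_left hA (abs_nonneg s)
      nlinarith
    refine le_of_mul_le_mul_right ?_ hpos
    linarith
  have h0 : h * |v 0| ≤ 2 * σ * ‖flatDeriv a v‖ := by
    refine hcoord _ ?_
    rw [← parallelogramArea_smul_add (v 0) (v 1)]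
    exact (parallelogramArea_le _ _).trans
      (mul_le_mul_of_nonneg_left (norm_vertex_sub_le a 2 0) (norm_nonneg _))
  have h1 : h * |v 1| ≤ 2 * σ * ‖flatDeriv a v‖ := by
    refine hcoord _ ?_
    change |v 1| * parallelogramArea (a 1 - a 0) (a 2 - a 0) ≤ _
    rw [parallelogramArea_comm, ← parallelogramArea_smul_add (v 1) (v 0), add_comm]
    exact (parallelogramArea_le _ _).trans
      (mul_le_mul_of_nonneg_left (norm_vertex_sub_le a 1 0) (norm_nonneg _))
  have hn : ‖v‖ ≤ 2 * σ * ‖flatDeriv a v‖ / h := by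
    refine (pi_norm_le_iff_of_nonneg (by positivity)).2 fun i => ?_
    rw [le_div_iff₀ hpos, mul_comm, Real.norm_eq_abs]
    fin_cases i
    exacts [h0, h1]
  rw [le_div_iff₀ hpos] at hn
  linarith

lemma norm_flatDeriv_le (a : Fin 3 → E3) (v : Fin 2 → ℝ) :
    ‖flatDeriv a v‖ ≤ 2 * triDiam a * ‖v‖ := by
  rw [flatDeriv_apply]
  refine (norm_add_le _ _).trans ?_
  rw [norm_smul, norm_smul]
  have h0 := mul_le_mul (norm_le_pi_norm v 0) (norm_vertex_sub_le a 1 0) (norm_nonneg _)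
    (norm_nonneg _)
  have h1 := mul_le_mul (norm_le_pi_norm v 1) (norm_vertex_sub_le a 2 0) (norm_nonneg _)
    (norm_nonneg _)
  linarith

/-! ### The curved elements -/

/-- The position and the tangent vectors of a curved element at the parameter `x`, in terms of the
diameter `h` of its flat element: the element lies in the tube within `O(h^{k+1})` of the surface,
its parametrization is bounded above and below by `h`, and it is tangential up to `O(h^k)`. -/
structure IsCurvedElementEstimate {k : ℕ} (Γ : Set E3) (ν : E3 → E3) (N : LagrangeElement k)
    (a : Fin 3 → E3) (r c B h : ℝ) (x : Fin 2 → ℝ) : Prop where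
  mem_ball : elementMap Γ N a x ∈ Metric.ball (a 0) r
  abs_signedDistance_le : |signedDistance Γ ν (elementMap Γ N a x)| ≤ B * h ^ (k + 1)
  le_norm_fderiv : ∀ v, c * h * ‖v‖ ≤ ‖fderiv ℝ (elementMap Γ N a) x v‖
  norm_fderiv_le : ∀ v, ‖fderiv ℝ (elementMap Γ N a) x v‖ ≤ B * h * ‖v‖
  abs_inner_le : ∀ v, |inner ℝ (surfaceNormal Γ ν (elementMap Γ N a x))
    (fderiv ℝ (elementMap Γ N a) x v)| ≤ B * h ^ k * ‖fderiv ℝ (elementMap Γ N a) x v‖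

/-- For the bound from below the derivative is compared with that of the affine parametrization: the
projection fixes the vertices, so `D(π ∘ L)` differs from `DL` by `O(h ^ 2)` only. For the normal
component, `D(π ∘ L)` is tangential at `π (L x)`, where the normal is `O(h ^ (k + 1))`-close. -/
lemma exists_isCurvedElementEstimate {Γ : Set E3} {ν : E3 → E3} (hc : IsCompact Γ) {k : ℕ}
    (hk : 1 ≤ k) (N : LagrangeElement k) {r M σ : ℝ} (hr : 0 < r) (hM : 1 ≤ M)
    (hT : IsTube Γ ν k r M) (hσ : 1 ≤ σ) :
    ∃ B ≥ 1, ∃ h₀ > 0, h₀ ≤ 1 ∧ ∀ a : Fin 3 → E3, (∀ i, a i ∈ Γ) → 0 < triDiam a →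
      triDiam a ≤ h₀ → triDiam a ≤ σ * inscribedDiam a → ∀ x ∈ refTriangle,
        IsCurvedElementEstimate Γ ν N a r (1 / (4 * σ)) B (triDiam a) x := by
  obtain ⟨Λ, hΛ, hbasis⟩ := exists_basis_bound N
  have hM0 : 0 < M := by linarith
  -- `E` bounds the interpolation error, `B₁` the normal component of the derivative
  set E := Λ * M with hE
  have hE0 : 0 ≤ E := by positivity
  set B₁ := E + 2 * M ^ 2 * E with hB₁
  have hB₁0 : 0 ≤ B₁ := by positivity
  set B := 1 + E + (2 + E + 2 * M) + 4 * σ * B₁ with hB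
  refine ⟨B, by nlinarith [mul_nonneg (by linarith : 0 ≤ σ) hB₁0],
    min 1 (min (r / (2 * (E + 3))) (1 / (4 * σ * (E + 2 * M)))), by positivity,
    min_le_left _ _, ?_⟩
  intro a ha hpos hh₀ hreg x hx
  set h := triDiam a
  have hh1 : h ≤ 1 := hh₀.trans (min_le_left _ _)
  have hhr : h * (2 * (E + 3)) ≤ r :=
    (le_div_iff₀ (by positivity)).1
      (hh₀.trans ((min_le_right _ _).trans (min_le_left _ _)))
  have hhσ : h * (4 * σ * (E + 2 * M)) ≤ 1 :=
    (le_div_iff₀ (by positivity)).1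
      (hh₀.trans ((min_le_right _ _).trans (min_le_right _ _)))
  have hpow1 : h ^ (k + 1) ≤ h := pow_le_of_le_one hpos.le hh1 (by omega)
  have hpow2 : h ^ (k + 1) ≤ h ^ 2 := pow_le_pow_of_le_one hpos.le hh1 (by omega)
  set S := convexHull ℝ (Set.range a)
  have hSball : ∀ z ∈ S, z ∈ Metric.ball (a 0) r := fun z hz => by
    have := dist_le_triDiam a hz (vertex_mem_convexHull a 0)
    rw [Metric.mem_ball]
    nlinarith
  have hreg' : ∀ z ∈ S, IsRegularPoint Γ ν (k + 2) z := fun z hz =>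
    hT.isRegularPoint (a 0) (ha 0) z (hSball z hz)
  have hLS : ∀ z ∈ refTriangle, flatMap a z ∈ S := fun z hz => flatMap_mem_convexHull a hz
  have hxS := hLS x hx
  have hf : ∀ z ∈ refTriangle, ContDiffAt ℝ (k + 1 : ℕ) (closestPoint Γ) (flatMap a z) :=
    fun z hz => (hreg' _ (hLS z hz)).contDiffAt_closestPoint.of_le
      (by exact_mod_cast (by omega : k + 1 ≤ k + 2))
  have hder : ∀ z ∈ refTriangle, ‖iteratedFDeriv ℝ (k + 1) (closestPoint Γ) (flatMap a z)‖ ≤ M :=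
    fun z hz => hT.norm_iteratedFDeriv_le (a 0) (ha 0) _ (hSball _ (hLS z hz)) _ le_rfl
  have hdist : ∀ z ∈ refTriangle, ‖flatMap a z - flatMap a x‖ ≤ h := fun z hz => by
    rw [← dist_eq_norm]; exact dist_le_triDiam a (hLS z hz) hxS
  set y := elementMap Γ N a x
  set q := closestPoint Γ (flatMap a x)
  have hqΓ : q ∈ Γ := (isNearestPoint_closestPoint hc ⟨a 0, ha 0⟩ _).1
  have hyq : ‖y - q‖ ≤ E * h ^ (k + 1) := by
    refine (norm_interpolant_sub_le N a hf hder hdist hx).trans ?_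
    rw [hE, mul_assoc]
    gcongr
    exact (hbasis x hx).1
  have hq0 : ‖q - a 0‖ ≤ 2 * h := by
    have h1 := dist_closestPoint_le hc (ha 0) (flatMap a x)
    have h2 := dist_le_triDiam a hxS (vertex_mem_convexHull a 0)
    rw [← dist_eq_norm]
    linarith
  have hyE : ‖y - q‖ ≤ E * h := hyq.trans (by gcongr)
  have hqball : q ∈ Metric.ball (a 0) r := by
    rw [mem_ball_iff_norm]
    nlinarith
  have hyball : y ∈ Metric.ball (a 0) r := by
    rw [mem_ball_iff_norm]
    have := norm_sub_le_norm_sub_add_norm_sub y q (a 0)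
    nlinarith
  have hd : |signedDistance Γ ν y| ≤ E * h ^ (k + 1) := by
    rw [abs_signedDistance]
    exact (Metric.infDist_le_dist_of_mem hqΓ).trans (by rwa [dist_eq_norm])
  set A := fderiv ℝ (elementMap Γ N a) x
  set Q₀ := fderiv ℝ (closestPoint Γ) (flatMap a x)
  have hQ₀ : ‖Q₀‖ ≤ M := by
    rw [← norm_iteratedFDeriv_one]
    exact hT.norm_iteratedFDeriv_le (a 0) (ha 0) _ (hSball _ hxS) 1 (by omega)
  have hA : ∀ v, ‖A v - Q₀ (flatDeriv a v)‖ ≤ E * h ^ (k + 1) * ‖v‖ := fun v => by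
    refine (norm_fderiv_interpolant_sub_le N a hk hf hder hdist hx v).trans ?_
    calc _ ≤ Λ * ‖v‖ * (M * h ^ (k + 1)) := by
          gcongr
          exact (hbasis x hx).2
      _ = _ := by rw [hE]; ring
  -- the vertices are fixed by the projection, whose differential varies by `O(h)` on the element
  have hedge : ∀ i : Fin 3, ‖Q₀ (a i - a 0) - (a i - a 0)‖ ≤ M * h * h := fun i => by
    have h1 := (convex_convexHull ℝ (Set.range a)).norm_image_sub_le_of_norm_hasFDerivWithin_le'
      (f := closestPoint Γ) (f' := fun z => fderiv ℝ (closestPoint Γ) z) (φ := Q₀) (C := M * h)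
      (fun z hz => (((hreg' z hz).contDiffAt_closestPoint.differentiableAt
        (by exact_mod_cast (by omega : k + 2 ≠ 0))).hasFDerivAt).hasFDerivWithinAt)
      (fun z hz => (hT.norm_fderiv_sub_le (a 0) (ha 0) z (hSball z hz) _ (hSball _ hxS)).trans (by
        gcongr
        rw [← dist_eq_norm]
        exact dist_le_triDiam a hz hxS))
      (vertex_mem_convexHull a 0) (vertex_mem_convexHull a i)
    rw [closestPoint_of_mem hc (ha i), closestPoint_of_mem hc (ha 0), norm_sub_rev] at h1
    exact h1.trans (by gcongr; exact norm_vertex_sub_le a i 0)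
  have hQL : ∀ v, ‖Q₀ (flatDeriv a v) - flatDeriv a v‖ ≤ 2 * M * h ^ 2 * ‖v‖ := fun v => by
    have e : Q₀ (flatDeriv a v) - flatDeriv a v = v 0 • (Q₀ (a 1 - a 0) - (a 1 - a 0)) +
        v 1 • (Q₀ (a 2 - a 0) - (a 2 - a 0)) := by
      rw [flatDeriv_apply, map_add, map_smul, map_smul]; module
    rw [e]
    refine (norm_add_le _ _).trans ?_
    rw [norm_smul, norm_smul]
    have h0 := mul_le_mul (norm_le_pi_norm v 0) (hedge 1) (norm_nonneg _) (norm_nonneg _)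
    have h1 := mul_le_mul (norm_le_pi_norm v 1) (hedge 2) (norm_nonneg _) (norm_nonneg _)
    linarith
  have hAL : ∀ v, ‖A v - flatDeriv a v‖ ≤ (E + 2 * M) * h ^ 2 * ‖v‖ := fun v => by
    have h1 := norm_sub_le_norm_sub_add_norm_sub (A v) (Q₀ (flatDeriv a v)) (flatDeriv a v)
    have h2 : E * h ^ (k + 1) * ‖v‖ ≤ E * h ^ 2 * ‖v‖ := by gcongr
    linarith [hA v, hQL v]
  have hlow : ∀ v, 1 / (4 * σ) * h * ‖v‖ ≤ ‖A v‖ := fun v => by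
    have h1 := triDiam_mul_norm_le (by linarith) hpos hreg v
    have h2 := norm_le_norm_add_norm_sub' (flatDeriv a v) (A v)
    rw [norm_sub_rev] at h2
    have h3 : 4 * σ * ((E + 2 * M) * h ^ 2 * ‖v‖) ≤ h * ‖v‖ := by
      calc _ = h * (4 * σ * (E + 2 * M)) * (h * ‖v‖) := by ring
        _ ≤ 1 * (h * ‖v‖) := by gcongr
        _ = _ := one_mul _
    have h4 : 4 * σ * ‖flatDeriv a v‖ ≤ 4 * σ * (‖A v‖ + (E + 2 * M) * h ^ 2 * ‖v‖) := by
      gcongr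
      exact h2.trans (by linarith [hAL v])
    have h5 : h * ‖v‖ ≤ 4 * σ * ‖A v‖ := by nlinarith
    rw [mul_assoc, div_mul_eq_mul_div, one_mul, div_le_iff₀ (by positivity)]
    linarith
  refine ⟨hyball, hd.trans ?_, hlow, fun v => ?_, fun v => ?_⟩
  · gcongr
    rw [hB]; nlinarith [mul_nonneg (by linarith : 0 ≤ σ) hB₁0]
  · have h1 := norm_le_norm_add_norm_sub' (A v) (flatDeriv a v)
    have h2 := norm_flatDeriv_le a v
    have h3 : (E + 2 * M) * h ^ 2 * ‖v‖ ≤ (E + 2 * M) * h * ‖v‖ := by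
      gcongr; nlinarith
    have h4 : (2 + E + 2 * M) * (h * ‖v‖) ≤ B * (h * ‖v‖) := by
      gcongr
      rw [hB]; nlinarith [mul_nonneg (by linarith : 0 ≤ σ) hB₁0]
    have h5 := hAL v
    change ‖flatDeriv a v‖ ≤ 2 * h * ‖v‖ at h2
    linarith
  · set n := surfaceNormal Γ ν y
    have hn : ‖n‖ = 1 := (hT.isRegularPoint (a 0) (ha 0) y hyball).norm_normal
    have hnq : ‖n - surfaceNormal Γ ν (flatMap a x)‖ ≤ M * (E * h ^ (k + 1)) := by
      have h1 := hT.norm_normal_sub_le (a 0) (ha 0) y hyball q hqball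
      have h2 : surfaceNormal Γ ν q = surfaceNormal Γ ν (flatMap a x) := by
        change ν (closestPoint Γ q) = ν q
        rw [closestPoint_of_mem hc hqΓ]
      rw [h2] at h1
      exact h1.trans (by gcongr)
    have e : inner ℝ n (A v) = inner ℝ n (A v - Q₀ (flatDeriv a v)) +
        inner ℝ (n - surfaceNormal Γ ν (flatMap a x)) (Q₀ (flatDeriv a v)) := by
      rw [inner_sub_left, (hreg' _ hxS).inner_normal_fderiv, sub_zero, inner_sub_right]
      ring
    have h1 : |inner ℝ n (A v - Q₀ (flatDeriv a v))| ≤ E * h ^ (k + 1) * ‖v‖ := by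
      refine (abs_real_inner_le_norm _ _).trans ?_
      rw [hn, one_mul]
      exact hA v
    have hQv : ‖Q₀ (flatDeriv a v)‖ ≤ M * (2 * ‖v‖) := by
      refine (Q₀.le_of_opNorm_le hQ₀ _).trans ?_
      gcongr
      refine (norm_flatDeriv_le a v).trans ?_
      change 2 * h * ‖v‖ ≤ _
      gcongr
      linarith
    have h2 : |inner ℝ (n - surfaceNormal Γ ν (flatMap a x)) (Q₀ (flatDeriv a v))| ≤
        M * (E * h ^ (k + 1)) * (M * (2 * ‖v‖)) :=
      (abs_real_inner_le_norm _ _).trans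
        (mul_le_mul hnq hQv (norm_nonneg _) (by positivity))
    have h3 : |inner ℝ n (A v)| ≤ B₁ * h ^ k * (h * ‖v‖) := by
      rw [e]
      refine (abs_add_le _ _).trans ((add_le_add h1 h2).trans (le_of_eq ?_))
      rw [hB₁]; ring
    have h4 : h * ‖v‖ ≤ 4 * σ * ‖A v‖ := by
      have := hlow v
      rw [mul_assoc, div_mul_eq_mul_div, one_mul, div_le_iff₀ (by positivity)] at this
      linarith
    calc _ ≤ B₁ * h ^ k * (h * ‖v‖) := h3
      _ ≤ B₁ * h ^ k * (4 * σ * ‖A v‖) := by gcongr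
      _ = 4 * σ * B₁ * h ^ k * ‖A v‖ := by ring
      _ ≤ B * h ^ k * ‖A v‖ := by
        gcongr
        rw [hB]
        linarith

lemma differentiable_elementMap {k : ℕ} (Γ : Set E3) (N : LagrangeElement k) (a : Fin 3 → E3) :
    Differentiable ℝ (elementMap Γ N a) := fun x =>
  (hasFDerivAt_sum_basis N (fun j => closestPoint Γ (flatMap a (N.node j))) x).differentiableAt

/-- The estimates on a curved element with `h` the diameter of its flat element. -/
lemma IsCurvedElementEstimate.estimates {Γ : Set E3} {ν : E3 → E3} {k : ℕ}
    (hk : 1 ≤ k) {N : LagrangeElement k} {a : Fin 3 → E3} {r M c B h : ℝ} {x : Fin 2 → ℝ}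
    (hT : IsTube Γ ν k r M) (ha : a 0 ∈ Γ) (hM : 1 ≤ M) (hc : 0 < c) (hB : 1 ≤ B)
    (hest : IsCurvedElementEstimate Γ ν N a r c B h x) (hh : 0 < h) (hh1 : h ≤ 1)
    {K : ℝ} (hK : K = B ^ 2 / c ^ 2) (hsmall : (8 + 96 * K ^ 2) * (2 * M * B ^ 2 * h) ≤ 1) :
    (|signedDistance Γ ν (elementMap Γ N a x)| ≤ 2 * M * B ^ 2 * h ^ (k + 1) ∧
      |1 - areaDeformation Γ N a x| ≤ 48 * K ^ 2 * (2 * M * B ^ 2 * h ^ (k + 1)) ∧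
      ∀ νh, IsDiscreteNormal Γ ν N a x νh →
        ‖surfaceNormal Γ ν (elementMap Γ N a x) - νh‖ ≤ 2 * (B * h ^ k) ∧
        ‖tangentialProjection (surfaceNormal Γ ν (elementMap Γ N a x)) -
          deformationTensor Γ ν (elementMap Γ N a x) (areaDeformation Γ N a x) νh‖ ≤
            2 * (48 * K ^ 2 + 4) * (2 * M * B ^ 2 * h ^ (k + 1))) ∧
    ∀ i : Fin 3, |1 - edgeDeformation Γ N a i x| ≤ 4 * (2 * M * B ^ 2 * h ^ (k + 1)) ∧
      (∀ νh, IsDiscreteNormal Γ ν N a x νh →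
        ‖tangentialProjection (surfaceNormal Γ ν (elementMap Γ N a x)) -
          deformationTensor Γ ν (elementMap Γ N a x) (edgeDeformation Γ N a i x) νh‖ ≤
            2 * (4 + 4) * (2 * M * B ^ 2 * h ^ (k + 1))) ∧
      ∀ n nh, IsOuterConormal (fderiv ℝ (liftMap Γ N a) x) i n →
        IsOuterConormal (fderiv ℝ (elementMap Γ N a) x) i nh →
        ‖n - tangentialProjection (surfaceNormal Γ ν (elementMap Γ N a x)) nh‖ ≤
          21 * (2 * M * B ^ 2 * h ^ (k + 1)) := by
  have hreg := hT.isRegularPoint (a 0) ha _ hest.mem_ball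
  set y := elementMap Γ N a x
  set n := surfaceNormal Γ ν y
  set A := fderiv ℝ (elementMap Γ N a) x
  set Q := fderiv ℝ (closestPoint Γ) y
  set η := 2 * M * B ^ 2 * h ^ (k + 1) with hη
  set ε := B * h ^ k with hε
  -- the factor `2 * M * B ^ 2` lets `η` dominate `ε ^ 2`, `M * |d|` and `|d| * ‖H‖` at once
  have hη0 : 0 ≤ η := by positivity
  have hε0 : 0 ≤ ε := by positivity
  have hpow1 : h ^ (k + 1) ≤ h := pow_le_of_le_one hh.le hh1 (by omega)
  have hηh : (8 + 96 * K ^ 2) * η ≤ 1 := by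
    refine le_trans ?_ hsmall
    rw [hη]
    gcongr
  have hη8 : η ≤ 1 / 8 := by nlinarith [mul_nonneg (sq_nonneg K) hη0]
  have hBB : B ≤ B ^ 2 := by nlinarith
  have hdM : M * |signedDistance Γ ν y| ≤ η := by
    calc _ ≤ M * (B ^ 2 * h ^ (k + 1)) := by
          gcongr
          exact hest.abs_signedDistance_le.trans (by gcongr)
      _ ≤ 2 * (M * (B ^ 2 * h ^ (k + 1))) := le_mul_of_one_le_left (by positivity) one_le_two
      _ = η := by rw [hη]; ring
  have hεη : ε ^ 2 ≤ η := by
    calc ε ^ 2 = B ^ 2 * h ^ (2 * k) := by rw [hε]; ring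
      _ ≤ B ^ 2 * h ^ (k + 1) := by
        gcongr ?_ * ?_
        exact pow_le_pow_of_le_one hh.le hh1 (by omega)
      _ ≤ (2 * M) * (B ^ 2 * h ^ (k + 1)) := le_mul_of_one_le_left (by positivity) (by linarith)
      _ = η := by rw [hη]; ring
  have hd : |signedDistance Γ ν y| ≤ η :=
    (le_mul_of_one_le_left (abs_nonneg _) hM).trans hdM
  have hQ : IsAlmostProjection n Q η :=
    ⟨hreg.norm_normal, (hT.norm_fderiv_sub_tangentialProjection_le (a 0) ha y hest.mem_ball).trans
      hdM, hη8, hreg.inner_normal_fderiv⟩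
  have hinj : Function.Injective A := by
    rw [injective_iff_map_eq_zero]
    intro v hv
    have := hest.le_norm_fderiv v
    change c * h * ‖v‖ ≤ ‖A v‖ at this
    rw [hv, norm_zero] at this
    have h2 : ‖v‖ ≤ 0 := by
      by_contra hpos
      push Not at hpos
      exact absurd this (not_le.2 (by positivity))
    exact norm_le_zero_iff.1 h2
  have hlift : fderiv ℝ (liftMap Γ N a) x = Q ∘L A :=
    fderiv_comp x (hreg.contDiffAt_closestPoint.differentiableAt
      (by exact_mod_cast (by omega : k + 2 ≠ 0))) (differentiable_elementMap Γ N a x)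
  have hH : ‖signedDistance Γ ν y • distanceHessian Γ ν y‖ ≤ η := by
    rw [norm_smul, Real.norm_eq_abs, mul_comm]
    refine le_trans ?_ hdM
    gcongr
    exact hT.norm_distanceHessian_le (a 0) ha y hest.mem_ball
  have hnormal : ∀ νh, IsDiscreteNormal Γ ν N a x νh → 1 - inner ℝ n νh ^ 2 ≤ ε ^ 2 := by
    intro νh hν
    refine one_sub_inner_sq_le hQ.norm_normal hν.1 hε0 fun w hw => ?_
    obtain ⟨v, rfl⟩ := mem_range_of_inner_eq_zero hinj hν.1 hν.2.1 hw
    exact hest.abs_inner_le v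
  have harea : |1 - areaDeformation Γ N a x| ≤ 48 * K ^ 2 * η := by
    set u := A (Pi.single 0 1)
    set v := A (Pi.single 1 1)
    have hlow : (c * h) ^ 2 ≤ parallelogramArea u v := by
      refine sq_le_parallelogramArea (by positivity) fun s t => ?_
      have e : s • u + t • v = A ![s, t] := by
        have : (![s, t] : Fin 2 → ℝ) = s • Pi.single 0 1 + t • Pi.single 1 1 := by
          ext i; fin_cases i <;> simp
        rw [this, map_add, map_smul, map_smul]
      rw [e]
      refine le_trans ?_ (hest.le_norm_fderiv _)
      gcongr
      exact max_le (norm_le_pi_norm ![s, t] 0) (norm_le_pi_norm ![s, t] 1)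
    have hup : ‖u‖ * ‖v‖ ≤ (B * h) * (B * h) := by
      have h1 := hest.norm_fderiv_le (Pi.single 0 1)
      have h2 := hest.norm_fderiv_le (Pi.single 1 1)
      rw [Pi.norm_single, norm_one, mul_one] at h1 h2
      exact mul_le_mul h1 h2 (norm_nonneg _) (by positivity)
    have hKu : ‖u‖ * ‖v‖ ≤ K * parallelogramArea u v := by
      refine hup.trans ?_
      have : (B * h) * (B * h) = K * (c * h) ^ 2 := by rw [hK]; field_simp
      rw [this]
      have hK0 : 0 ≤ K := by rw [hK]; positivity
      gcongr
    have := hQ.abs_one_sub_area_div_le hεη (hest.abs_inner_le _) (hest.abs_inner_le _)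
      (lt_of_lt_of_le (by positivity) hlow) hKu
    rw [areaDeformation, hlift]
    exact this
  have hedge : ∀ i, |1 - edgeDeformation Γ N a i x| ≤ 4 * η := fun i => by
    rw [edgeDeformation, hlift]
    refine hQ.abs_one_sub_norm_div_le hεη (fun h0 => edgeDir_ne_zero i ?_) (hest.abs_inner_le _)
    exact hinj (h0.trans (map_zero A).symm)
  refine ⟨⟨hd, harea, fun νh hν => ⟨?_, ?_⟩⟩, fun i => ⟨hedge i, fun νh hν => ?_, ?_⟩⟩
  · exact norm_sub_le_of_one_sub_inner_sq_le hQ.norm_normal hν.1 hε0 hν.2.2 (hnormal νh hν)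
  · exact norm_projection_sub_deformation_le hQ.norm_normal hν.1 ((hnormal νh hν).trans hεη) hH
      (by linarith) harea (harea.trans (by linarith))
  · exact norm_projection_sub_deformation_le hQ.norm_normal hν.1 ((hnormal νh hν).trans hεη) hH
      (by linarith) (hedge i) ((hedge i).trans (by linarith))
  · intro m mh hm hmh
    rw [hlift] at hm
    exact hQ.norm_conormal_sub_le hεη hinj hest.abs_inner_le hm hmh

lemma triDiam_le_meshSize {T : Geometry.SimplicialComplex ℝ E3} (hT : T.faces.Finite)
    {a : Fin 3 → E3} (ha : IsElement T a) : triDiam a ≤ meshSize T := by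
  obtain ⟨-, t, ht, hta⟩ := ha
  exact le_csSup (hT.image _).bddAbove ⟨t, ht, by simp only [hta, triDiam]⟩

lemma inscribedDiam_nonneg (a : Fin 3 → E3) : 0 ≤ inscribedDiam a := by
  have := parallelogramArea_nonneg (a 1 - a 0) (a 2 - a 0)
  unfold inscribedDiam
  positivity

end SurfaceDG
end

open SurfaceDG
theorem lemma4p1 (Γ : Set E3) (ν : E3 → E3) (hcompact : IsCompact Γ) (hconn : IsConnected Γ)
    (hΓ : IsOrientedSmoothSurface Γ ν) (k : ℕ) (hk : 1 ≤ k) (N : LagrangeElement k) (σ : ℝ) :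
    ∃ C > 0, ∃ h₀ > 0, ∀ T : Geometry.SimplicialComplex ℝ E3,
      IsInscribedTriangulation Γ T → IsShapeRegular σ T → meshSize T ≤ h₀ →
      ∀ a : Fin 3 → E3, IsElement T a →
        -- all points of the curved element, with parameter x
        (∀ x ∈ refTriangle,
          |signedDistance Γ ν (elementMap Γ N a x)| ≤ C * meshSize T ^ (k + 1) ∧
          |1 - areaDeformation Γ N a x| ≤ C * meshSize T ^ (k + 1) ∧
          ∀ νh, IsDiscreteNormal Γ ν N a x νh →
            ‖surfaceNormal Γ ν (elementMap Γ N a x) - νh‖ ≤ C * meshSize T ^ k ∧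
            ‖tangentialProjection (surfaceNormal Γ ν (elementMap Γ N a x)) -
              deformationTensor Γ ν (elementMap Γ N a x) (areaDeformation Γ N a x) νh‖
              ≤ C * meshSize T ^ (k + 1)) ∧
        -- all points of each of its three edges, seen from this element
        (∀ i : Fin 3, ∀ x ∈ refEdge i,
          |1 - edgeDeformation Γ N a i x| ≤ C * meshSize T ^ (k + 1) ∧
          (∀ νh, IsDiscreteNormal Γ ν N a x νh →
            ‖tangentialProjection (surfaceNormal Γ ν (elementMap Γ N a x)) -
              deformationTensor Γ ν (elementMap Γ N a x) (edgeDeformation Γ N a i x) νh‖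
              ≤ C * meshSize T ^ (k + 1)) ∧
          ∀ n nh, IsOuterConormal (fderiv ℝ (liftMap Γ N a) x) i n →
            IsOuterConormal (fderiv ℝ (elementMap Γ N a) x) i nh →
            ‖n - tangentialProjection (surfaceNormal Γ ν (elementMap Γ N a x)) nh‖
              ≤ C * meshSize T ^ (k + 1)) := by
  obtain ⟨r, hr, M, hM, htube⟩ := exists_isTube hcompact hΓ hk
  obtain ⟨B, hB, h₁, hh₁, hh₁1, hest⟩ := exists_isCurvedElementEstimate hcompact hk N hr hM htube
    (le_max_right σ 1)
  -- shape regularity passes to larger constants, as inscribed diameters are nonnegative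
  set σ' := max σ 1
  have hσ' : 0 < σ' := lt_of_lt_of_le one_pos (le_max_right σ 1)
  set c := 1 / (4 * σ') with hc
  have hc0 : 0 < c := by positivity
  obtain ⟨K, hK⟩ : ∃ K, K = B ^ 2 / c ^ 2 := ⟨_, rfl⟩
  set D := 2 * M * B ^ 2 with hD
  have hD0 : 0 < D := by positivity
  set C := (30 + 96 * K ^ 2) * D + 2 * B with hC
  refine ⟨C, by positivity, min h₁ (1 / ((8 + 96 * K ^ 2) * D)), by positivity, ?_⟩
  intro T hT hreg hmesh a ha
  have haΓ : ∀ i, a i ∈ Γ := fun i => by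
    obtain ⟨-, t, ht, hta⟩ := ha
    exact hT.vertices_mem t ht (hta ▸ ⟨i, rfl⟩)
  have hdm := triDiam_le_meshSize hT.finite ha
  set h := triDiam a
  have hpos : 0 < h :=
    (norm_pos_iff.2 (sub_ne_zero.2 (ha.1.ne (by decide : (1 : Fin 3) ≠ 0)))).trans_le
      (norm_vertex_sub_le a 1 0)
  have hh : h ≤ h₁ := hdm.trans (hmesh.trans (min_le_left _ _))
  have hsmall : (8 + 96 * K ^ 2) * (D * h) ≤ 1 := by
    have := (le_div_iff₀ (by positivity)).1 (hdm.trans (hmesh.trans (min_le_right _ _)))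
    linarith
  have hsr : h ≤ σ' * inscribedDiam a := (hreg a ha).trans
    (mul_le_mul_of_nonneg_right (le_max_left _ _) (inscribedDiam_nonneg a))
  have main := fun x hx => (hest a haΓ hpos hh hsr x hx).estimates hk htube (haΓ 0) hM hc0 hB hpos
    (hh.trans hh₁1) hK hsmall
  have hup : ∀ {b : ℝ}, 0 ≤ b → b ≤ 30 + 96 * K ^ 2 →
      b * (D * h ^ (k + 1)) ≤ C * meshSize T ^ (k + 1) := fun {b} hb0 hb => by
    have h1 : b * D ≤ C := by
      rw [hC]
      nlinarith
    calc _ = b * D * h ^ (k + 1) := by ring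
      _ ≤ _ := by gcongr
  have hK2 := sq_nonneg K
  refine ⟨fun x hx => ?_, fun i x hx => ?_⟩
  · obtain ⟨⟨e1, e2, e3⟩, -⟩ := main x hx
    refine ⟨?_, e2.trans (hup (by positivity) (by linarith)), fun νh hν => ⟨?_,
      (e3 νh hν).2.trans (hup (by positivity) (by linarith))⟩⟩
    · have := hup (b := 1) zero_le_one (by linarith)
      rw [one_mul] at this
      exact e1.trans this
    · refine (e3 νh hν).1.trans ?_
      rw [← mul_assoc]
      have h1 : 2 * B ≤ C := by rw [hC]; nlinarith
      gcongr
  · obtain ⟨-, e⟩ := main x hx.1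
    obtain ⟨e1, e2, e3⟩ := e i
    exact ⟨e1.trans (hup (by norm_num) (by linarith)),
      fun νh hν => (e2 νh hν).trans (hup (by norm_num) (by linarith)),
      fun n nh hn hnh => (e3 n nh hn hnh).trans (hup (by norm_num) (by linarith))⟩
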